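/- Let $c>0$ be a constant, and for every integer $d\ge 1$ let $G_d$ be a finite (non-empty) $d$-regular graph. Put $p=p(d)=c/d$ (for $d\ge c$) and let $G_{d,p}$ be the random spanning subgraph of $G_d$ obtained by retaining each edge independently with probability $p$. For a graph $H$, a vertex $v$ and $r\ge 1$, let $B^r_H[v]$ be the subgraph of $H$ induced by the vertices at distance at most $r$ from $v$, rooted at $v$; rooted graphs are considered up to root-preserving isomorphism. Let $\mu_{r,d}$ be the (random) law, given $G_{d,p}$, of $B^r_{G_{d,p}}[v]$ for a uniformly random vertex $v$, that is, $\mu_{r,d}(H,u)=\frac{1}{|V(G_d)|}\,|\{v: B^r_{G_{d,p}}[v]\simeq (H,u)\}|$ for every finite rooted graph $(H,u)$. Let $\mathrm{GW}_c$ be the Galton--Watson tree with offspring distribution $\mathrm{Po}(c)$, with root $o$, and let $\mu_r$ be the law of $B^r_{\mathrm{GW}_c}[o]$. Let $d_{\mathrm{TV}}(\mu,\nu)=\sup_A|\mu(A)-\nu(A)|$. Then, for every fixed integer $r\ge 1$, as $d\to\infty$, \[\mathbb P\left(d_{\mathrm{TV}}(\mu_{r,d},\mu_r)\ge \exp\left(-\tfrac14(\log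 d)^{1/(2r)}\right)\right)=o(d^{-1/3}).\] In particular, $(G_{d,p})_{d\ge 1}$ converges locally in probability to $\mathrm{GW}_c$: for every $r\ge 1$ and every finite rooted graph $(H,u)$, $\mu_{r,d}(H,u)\to \mathbb P(B^r_{\mathrm{GW}_c}[o]\simeq (H,u))$ in probability as $d\to\infty$. -/

import Mathlib

open MeasureTheory ProbabilityTheory Filter Asymptotics
open scoped Topology NNReal ENNReal unitInterval

noncomputable section

namespace LocalLimit

/-! ### Rooted graphs and balls -/

/-- Isomorphism of rooted graphs. -/
def RootedIso {V W : Type*} (G : SimpleGraph V) (v : V) (H : SimpleGraph W) (w : W) : Prop :=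
  ∃ φ : G ≃g H, φ v = w

/-- A finite rooted graph, with the vertices labelled by an initial segment of `ℕ`. -/
structure FinRooted where
  /-- The number of vertices. -/
  size : ℕ
  /-- The graph. -/
  graph : SimpleGraph (Fin size)
  /-- The root. -/
  root : Fin size

/-- Two finite rooted graphs are identified when they are isomorphic as rooted graphs. -/
instance FinRooted.setoid : Setoid FinRooted where
  r K L := RootedIso K.graph K.root L.graph L.root
  iseqv :=
    { refl := fun _ => ⟨SimpleGraph.Iso.refl, rfl⟩
      symm := by
        rintro K L ⟨φ, h⟩
        exact ⟨φ.symm, by rw [← h]; exact φ.symm_apply_apply _⟩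
      trans := by
        rintro K L M ⟨φ, h⟩ ⟨ψ, h'⟩
        exact ⟨φ.trans ψ, by rw [← h', ← h]; rfl⟩ }

/-- The (countable) set of finite rooted graphs up to isomorphism. -/
def RootedClass : Type := Quotient FinRooted.setoid

/-- Every set of isomorphism classes is an event. -/
instance : MeasurableSpace RootedClass := ⊤

instance : DiscreteMeasurableSpace RootedClass := ⟨fun _ => trivial⟩

/-- The isomorphism class of the finite rooted graph `(G, v)`. -/
def rootedClass {V : Type*} [Finite V] (G : SimpleGraph V) (v : V) : RootedClass :=
  Quotient.mk FinRooted.setoid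
    ⟨Nat.card V, G.comap (Finite.equivFin V).symm, Finite.equivFin V v⟩

theorem rootedClass_eq_mk_iff {V : Type*} [Finite V] (G : SimpleGraph V) (v : V)
    (K : FinRooted) :
    rootedClass G v = Quotient.mk FinRooted.setoid K ↔ RootedIso G v K.graph K.root := by
  have hφ : ∃ φ : G ≃g G.comap (Finite.equivFin V).symm, φ v = Finite.equivFin V v :=
    ⟨⟨Finite.equivFin V, by simp⟩, rfl⟩
  obtain ⟨φ, hφ⟩ := hφ
  refine Quotient.eq.trans ⟨?_, ?_⟩
  · rintro ⟨ψ, h⟩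
    exact ⟨φ.trans ψ, by rw [← h]; exact congrArg ψ hφ⟩
  · rintro ⟨ψ, h⟩
    exact ⟨φ.symm.trans ψ, by
      rw [← h]; exact congrArg ψ (φ.symm_apply_eq.2 hφ.symm)⟩

/-- The set of vertices at distance at most `r` from `v`. -/
def closedNbhd {V : Type*} (G : SimpleGraph V) (v : V) (r : ℕ) : Set V :=
  {w | G.edist v w ≤ r}

/-- The ball of radius `r` around `v`: the graph induced by the vertices at distance
at most `r` from `v`. -/
def ballGraph {V : Type*} (G : SimpleGraph V) (v : V) (r : ℕ) :
    SimpleGraph (closedNbhd G v r) :=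
  G.induce (closedNbhd G v r)

/-- The vertex `v`, as the root of the ball around it. -/
def ballRoot {V : Type*} (G : SimpleGraph V) (v : V) (r : ℕ) : closedNbhd G v r :=
  ⟨v, by simp [closedNbhd]⟩

/-- The isomorphism class of the ball of radius `r` around `v`, rooted at `v`. -/
def ballClass {V : Type*} (G : SimpleGraph V) (v : V) (r : ℕ) [Finite (closedNbhd G v r)] :
    RootedClass :=
  rootedClass (ballGraph G v r) (ballRoot G v r)

/-! ### Edge percolation and empirical neighbourhood distributions -/

/-- The law of the spanning random subgraph `G_p` of `G`, in which every edge of `G` is retained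
independently with probability `p`. -/
def percolation {V : Type*} (G : SimpleGraph V) (p : I) : Measure (SimpleGraph V) :=
  (setBernoulli G.edgeSet p).map SimpleGraph.fromEdgeSet

/-- The probability `c / d`; it is truncated at `1`, which only matters for `d < c`. -/
def edgeProb (c : ℝ≥0) (d : ℕ) : I :=
  ⟨min ((c : ℝ) / d) 1, le_min (by positivity) zero_le_one, min_le_right _ _⟩

/-- The law of the ball of radius `r` around a uniformly random vertex of the finite graph `H`. -/
def empiricalBallLaw {V : Type*} [Fintype V] (H : SimpleGraph V) (r : ℕ) : Measure RootedClass :=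
  (Fintype.card V : ℝ≥0∞)⁻¹ • ∑ v : V, Measure.dirac (ballClass H v r)

/-- The total variation distance of two probability measures. -/
def tvDist {Ω : Type*} [MeasurableSpace Ω] (μ ν : Measure Ω) : ℝ :=
  ⨆ A : {A : Set Ω // MeasurableSet A}, |μ.real A.1 - ν.real A.1|

/-! ### The Galton–Watson tree -/

/-- `IsGWVertex N u`: the word `u` is a vertex of the family tree in which the individual `u`
has `N u` children. The root is the empty word, the children of `u` are the words `i :: u` with
`i < N u`. -/
def IsGWVertex (N : List ℕ → ℕ) : List ℕ → Prop
  | [] => True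
  | i :: u => IsGWVertex N u ∧ i < N u

/-- The family tree with offspring numbers `N`: every vertex is joined to its children. -/
def gwTree (N : List ℕ → ℕ) : SimpleGraph {u : List ℕ // IsGWVertex N u} where
  Adj u w := (∃ i, u.1 = i :: w.1) ∨ (∃ i, w.1 = i :: u.1)
  symm := ⟨fun _ _ h => h.symm⟩
  loopless := ⟨by
    rintro u (⟨i, h⟩ | ⟨i, h⟩) <;> simpa using congrArg List.length h⟩

/-- The root of the family tree. -/
def gwRoot (N : List ℕ → ℕ) : {u : List ℕ // IsGWVertex N u} := ⟨[], trivial⟩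

/-- The law of the offspring numbers of the Galton–Watson tree with `Po(c)` offspring
distribution: independent `Po(c)` variables. The tree itself is `gwTree N` with `N` of this law. -/
def gwMeasure (c : ℝ≥0) : Measure (List ℕ → ℕ) :=
  Measure.infinitePi fun _ => poissonMeasure c

theorem gwTree_length_le {N : List ℕ → ℕ} {u w : {u : List ℕ // IsGWVertex N u}}
    (p : (gwTree N).Walk u w) : w.1.length ≤ u.1.length + p.length := by
  induction p with
  | nil => simp
  | cons h p ih =>
    rw [SimpleGraph.Walk.length_cons]
    rcases h with ⟨i, h⟩ | ⟨i, h⟩ <;>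
      · have := congrArg List.length h
        simp only [List.length_cons] at this
        omega

theorem gwTree_edist_le {N : List ℕ → ℕ} (u : List ℕ) (hu : IsGWVertex N u) :
    (gwTree N).edist (gwRoot N) ⟨u, hu⟩ ≤ u.length := by
  induction u with
  | nil => simp [gwRoot]
  | cons i u ih =>
    have hadj : (gwTree N).Adj ⟨u, hu.1⟩ ⟨i :: u, hu⟩ := Or.inr ⟨i, rfl⟩
    calc (gwTree N).edist (gwRoot N) ⟨i :: u, hu⟩
        ≤ (gwTree N).edist (gwRoot N) ⟨u, hu.1⟩ + (gwTree N).edist ⟨u, hu.1⟩ ⟨i :: u, hu⟩ :=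
          (gwTree N).edist_triangle
      _ ≤ (u.length : ℕ∞) + 1 := by
          refine add_le_add (ih hu.1) ?_
          simpa using SimpleGraph.edist_le hadj.toWalk
      _ = ((i :: u).length : ℕ∞) := by simp

/-- The ball of radius `r` around the root consists of the first `r` generations. -/
theorem mem_closedNbhd_gwTree {N : List ℕ → ℕ} {r : ℕ} {u : {u : List ℕ // IsGWVertex N u}} :
    u ∈ closedNbhd (gwTree N) (gwRoot N) r ↔ u.1.length ≤ r := by
  constructor
  · intro h
    obtain ⟨p, hp⟩ := SimpleGraph.exists_walk_of_edist_ne_top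
      (ne_top_of_le_ne_top (ENat.natCast_ne_top r) h)
    have h1 := gwTree_length_le p
    have h2 : p.length ≤ r := by
      have : (p.length : ℕ∞) ≤ r := hp ▸ h
      exact_mod_cast this
    have h3 : (gwRoot N).1.length = 0 := rfl
    omega
  · intro h
    exact (gwTree_edist_le u.1 u.2).trans (by exact_mod_cast h)

theorem finite_gwGenerations (N : List ℕ → ℕ) (r : ℕ) :
    {u : List ℕ | IsGWVertex N u ∧ u.length ≤ r}.Finite := by
  induction r with
  | zero =>
    refine (Set.finite_singleton []).subset ?_
    rintro u ⟨-, h⟩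
    simpa using h
  | succ r ih =>
    refine ((Set.finite_singleton []).union
      (ih.biUnion fun u _ => (Set.finite_lt_nat (N u)).image fun i => i :: u)).subset ?_
    rintro (_ | ⟨i, u⟩) ⟨hu, h⟩
    · simp
    · refine Or.inr (Set.mem_biUnion (x := u) ⟨hu.1, by simpa using h⟩ ⟨i, hu.2, rfl⟩)

/-- Balls in the Galton–Watson tree are finite. -/
instance finite_gwBall (N : List ℕ → ℕ) (r : ℕ) :
    Finite (closedNbhd (gwTree N) (gwRoot N) r) := by
  have := (finite_gwGenerations N r).to_subtype
  refine Finite.of_injective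
    (fun u : closedNbhd (gwTree N) (gwRoot N) r =>
      (⟨u.1.1, u.1.2, mem_closedNbhd_gwTree.1 u.2⟩ :
        {u : List ℕ | IsGWVertex N u ∧ u.length ≤ r})) ?_
  intro u w h
  exact Subtype.ext (Subtype.ext (congrArg (fun x => x.1) h))

/-- The law of the ball of radius `r` around the root of the `Po(c)` Galton–Watson tree, i.e. of
the Galton–Watson tree truncated at depth `r`. -/
def gwBallLaw (c : ℝ≥0) (r : ℕ) : Measure RootedClass :=
  (gwMeasure c).map fun N => ballClass (gwTree N) (gwRoot N) r

theorem isGWVertex_congr {N M : List ℕ → ℕ} {r : ℕ}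
    (h : ∀ u, IsGWVertex N u → u.length ≤ r → M u = N u) (u : List ℕ) (hu : u.length ≤ r) :
    IsGWVertex N u ↔ IsGWVertex M u := by
  induction u with
  | nil => exact Iff.rfl
  | cons i u ih =>
    have hu' : u.length ≤ r := (Nat.le_succ _).trans hu
    simp only [IsGWVertex]
    rw [← ih hu']
    exact and_congr_right fun h1 => by rw [h u h1 hu']

theorem ballClass_gwTree_congr {N M : List ℕ → ℕ} {r : ℕ}
    (h : ∀ u, IsGWVertex N u → u.length ≤ r → M u = N u) :
    ballClass (gwTree N) (gwRoot N) r = ballClass (gwTree M) (gwRoot M) r := by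
  have key := isGWVertex_congr h
  refine (rootedClass_eq_mk_iff _ _ _).2 ?_
  let e : closedNbhd (gwTree N) (gwRoot N) r ≃ closedNbhd (gwTree M) (gwRoot M) r :=
    { toFun := fun u => ⟨⟨u.1.1, (key _ (mem_closedNbhd_gwTree.1 u.2)).1 u.1.2⟩,
        mem_closedNbhd_gwTree.2 (mem_closedNbhd_gwTree.1 u.2 :)⟩
      invFun := fun u => ⟨⟨u.1.1, (key _ (mem_closedNbhd_gwTree.1 u.2)).2 u.1.2⟩,
        mem_closedNbhd_gwTree.2 (mem_closedNbhd_gwTree.1 u.2 :)⟩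
      left_inv := fun _ => rfl
      right_inv := fun _ => rfl }
  let φ : ballGraph (gwTree N) (gwRoot N) r ≃g ballGraph (gwTree M) (gwRoot M) r :=
    ⟨e, Iff.rfl⟩
  obtain ⟨ψ, hψ⟩ := (rootedClass_eq_mk_iff (ballGraph (gwTree M) (gwRoot M) r)
    (ballRoot (gwTree M) (gwRoot M) r) _).1 rfl
  exact ⟨φ.trans ψ, hψ⟩

/-- The truncated tree is a measurable function of the offspring numbers. -/
theorem measurable_gwBall (r : ℕ) :
    Measurable fun N : List ℕ → ℕ => ballClass (gwTree N) (gwRoot N) r := by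
  intro A _
  refine IsOpen.measurableSet (isOpen_iff_mem_nhds.2 fun N hN => ?_)
  have hfin := finite_gwGenerations N r
  have hopen : IsOpen
      {M : List ℕ → ℕ | ∀ u ∈ {u : List ℕ | IsGWVertex N u ∧ u.length ≤ r}, M u = N u} := by
    have : {M : List ℕ → ℕ | ∀ u ∈ {u : List ℕ | IsGWVertex N u ∧ u.length ≤ r}, M u = N u}
        = Set.pi {u : List ℕ | IsGWVertex N u ∧ u.length ≤ r} fun u => {N u} := by
      ext M
      simp [Set.mem_pi]
    rw [this]
    exact isOpen_set_pi hfin fun _ _ => isOpen_discrete _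
  refine Filter.mem_of_superset (hopen.mem_nhds fun _ _ => rfl) fun M hM => ?_
  have := ballClass_gwTree_congr (N := N) (M := M) (r := r) fun u h1 h2 => hM u ⟨h1, h2⟩
  change ballClass (gwTree M) (gwRoot M) r ∈ A
  rw [← this]
  exact hN

/-! ### Local convergence in probability -/

/-- The random finite graphs with laws `ν d` converge locally in probability, as `d → ∞`, to the
random rooted graph `(T ω, o ω)`: for every `r ≥ 1` and every finite rooted graph `K`, the
proportion of the vertices of the random graph whose ball of radius `r` is isomorphic to `K`
converges in probability to the probability that the ball of radius `r` around the root `o` of `T`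
is isomorphic to `K`. -/
def ConvergesLocallyInProbability {V : ℕ → Type*} (ν : ∀ d, Measure (SimpleGraph (V d)))
    {Ω : Type*} [MeasurableSpace Ω] (P : Measure Ω) {W : Ω → Type*}
    (T : ∀ ω, SimpleGraph (W ω)) (o : ∀ ω, W ω) : Prop :=
  ∀ r : ℕ, 1 ≤ r → ∀ K : FinRooted, ∀ ε : ℝ, 0 < ε →
    Tendsto (fun d => (ν d).real {H : SimpleGraph (V d) |
      ε ≤ |(Nat.card {v : V d // RootedIso (ballGraph H v r) (ballRoot H v r) K.graph K.root} : ℝ)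
            / Nat.card (V d)
          - P.real {ω | RootedIso (ballGraph (T ω) (o ω) r) (ballRoot (T ω) (o ω) r)
              K.graph K.root}|})
      atTop (𝓝 0)

end LocalLimit

end

/-! For two probability measures, the one-sided bound `ν(A) ≤ μ(A) + δ` for all events already
bounds the total variation distance (`tvDist_le_of_forall`). So it is enough that every plane tree
`τ` of depth at most `r` with at most `Δ` children per vertex appears as the ball of nearly as many
vertices as its Galton–Watson weight predicts. Upper bounds on the counts and information on short
cycles of `G` are not needed.

A linear order on the vertices of `G` turns tree balls into plane trees: children are listed
increasingly, and a ball then matches at most one `τ` (`IsOrderedChart.offspring_unique`). Thus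
events for different `τ` are disjoint, and weights are plain products of Poisson masses, without
symmetry factors.

Expectation: let `K` bound the number of vertices of `τ`. When the children of a vertex are chosen,
at most `K` of its `d` neighbours are in use, so there are at least `∏ (d - K).choose (τ u)`
embedded copies at a given root (`exists_preCharts`). A copy is the ball when its edges are open and
the other relevant edges are closed. Adding these disjoint events gives the Poisson product up to
`O(K² / d)` (`le_bernExp_chartEvent`, `treeWeight_sub_le`).

Concentration: changing one edge affects only roots reached from its endpoints through vertices of
degree at most `Δ + 1`. Percolated degrees have bounded second moment, so Efron–Stein gives variance
`O(n (Δ + 2)^(2r))` for the count (`treeCount_variance_le`). As `n ≥ d`, Chebyshev and a union bound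
over at most `Q` trees give failure probability `O(Q³ (Δ + 2)^(2r) / (d ε²))`
(`percolation_tvDist_le`).

Finally put `x = (log d)^(1/(2r))`, `Δ = ⌈x⌉`, `ε = exp(-x/4)`. Then `log Q = O(x^r log x) = o(log
d)`, and the Poisson tail `exp(-2Δ)` takes care of unbounded trees; the failure probability is
`O(d^(-2/3))`. Local convergence follows by testing the distance on singletons. -/

namespace LocalLimit

/-! ### Expectations over random subsets of a finite set -/

section BernoulliSubsets

variable {α : Type*} [DecidableEq α]

/-- The expectation of `f S`, where `S` is the random subset of the finite set `E` which contains
every element independently with probability `p`. -/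
noncomputable def bernExp (p : ℝ) (E : Finset α) (f : Finset α → ℝ) : ℝ :=
  ∑ S ∈ E.powerset, p ^ S.card * (1 - p) ^ (E \ S).card * f S

theorem bernExp_empty (p : ℝ) (f : Finset α → ℝ) : bernExp p ∅ f = f ∅ := by
  simp [bernExp]

/-- Conditioning on whether `e` is present; this recursion drives the inductions on `E`. -/
theorem bernExp_insert (p : ℝ) {E : Finset α} {e : α} (he : e ∉ E) (f : Finset α → ℝ) :
    bernExp p (insert e E) f =
      (1 - p) * bernExp p E f + p * bernExp p E fun S => f (insert e S) := by
  unfold bernExp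
  rw [Finset.sum_powerset_insert he, Finset.mul_sum, Finset.mul_sum]
  congr 1
  · refine Finset.sum_congr rfl fun S hS => ?_
    have hS' := Finset.mem_powerset.1 hS
    have heS : e ∉ S := fun h => he (hS' h)
    rw [Finset.insert_sdiff_of_notMem _ heS,
      Finset.card_insert_of_notMem (fun h => he (Finset.mem_sdiff.1 h).1)]
    ring
  · refine Finset.sum_congr rfl fun S hS => ?_
    have hS' := Finset.mem_powerset.1 hS
    have heS : e ∉ S := fun h => he (hS' h)
    rw [Finset.insert_sdiff_insert, Finset.sdiff_insert_of_notMem he,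
      Finset.card_insert_of_notMem heS]
    ring

theorem bernExp_congr {p : ℝ} {E : Finset α} {f g : Finset α → ℝ} (h : ∀ S ⊆ E, f S = g S) :
    bernExp p E f = bernExp p E g :=
  Finset.sum_congr rfl fun S hS => by rw [h S (Finset.mem_powerset.1 hS)]

theorem bernExp_mono {p : ℝ} (h0 : 0 ≤ p) (h1 : p ≤ 1) {E : Finset α} {f g : Finset α → ℝ}
    (h : ∀ S ⊆ E, f S ≤ g S) : bernExp p E f ≤ bernExp p E g :=
  Finset.sum_le_sum fun S hS => mul_le_mul_of_nonneg_left (h S (Finset.mem_powerset.1 hS))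
    (mul_nonneg (pow_nonneg h0 _) (pow_nonneg (by linarith) _))

theorem bernExp_add (p : ℝ) (E : Finset α) (f g : Finset α → ℝ) :
    bernExp p E (fun S => f S + g S) = bernExp p E f + bernExp p E g := by
  simp only [bernExp, mul_add, Finset.sum_add_distrib]

theorem bernExp_const_mul (p : ℝ) (E : Finset α) (a : ℝ) (f : Finset α → ℝ) :
    bernExp p E (fun S => a * f S) = a * bernExp p E f := by
  simp only [bernExp, Finset.mul_sum]
  exact Finset.sum_congr rfl fun S _ => by ring

theorem bernExp_sum {ι : Type*} (p : ℝ) (E : Finset α) (s : Finset ι) (f : ι → Finset α → ℝ) :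
    bernExp p E (fun S => ∑ i ∈ s, f i S) = ∑ i ∈ s, bernExp p E (f i) := by
  simp only [bernExp, Finset.mul_sum]
  exact Finset.sum_comm

theorem bernExp_const (p : ℝ) (E : Finset α) (a : ℝ) : bernExp p E (fun _ => a) = a := by
  induction E using Finset.induction_on with
  | empty => simp [bernExp_empty]
  | insert e E he ih => rw [bernExp_insert p he, ih]; ring

theorem bernExp_nonneg {p : ℝ} (h0 : 0 ≤ p) (h1 : p ≤ 1) {E : Finset α} {f : Finset α → ℝ}
    (h : ∀ S ⊆ E, 0 ≤ f S) : 0 ≤ bernExp p E f :=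
  (bernExp_const p E 0).symm.trans_le (bernExp_mono h0 h1 h)

theorem bernExp_sq_sub (p : ℝ) (E : Finset α) (f : Finset α → ℝ) (a : ℝ) :
    bernExp p E (fun S => (f S - a) ^ 2) =
      bernExp p E (fun S => f S ^ 2) - 2 * a * bernExp p E f + a ^ 2 := by
  have : (fun S => (f S - a) ^ 2) = fun S => (f S ^ 2 + (-2 * a) * f S) + a ^ 2 := by
    ext S; ring
  rw [this, bernExp_add, bernExp_add, bernExp_const_mul, bernExp_const]
  ring

theorem sq_bernExp_le {p : ℝ} (h0 : 0 ≤ p) (h1 : p ≤ 1) (E : Finset α) (f : Finset α → ℝ) :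
    bernExp p E f ^ 2 ≤ bernExp p E fun S => f S ^ 2 := by
  have h := bernExp_nonneg h0 h1 (E := E) (f := fun S => (f S - bernExp p E f) ^ 2)
    fun S _ => sq_nonneg _
  rw [bernExp_sq_sub] at h
  linarith

/-- The Efron–Stein inequality. -/
theorem bernExp_variance_le {p : ℝ} (h0 : 0 ≤ p) (h1 : p ≤ 1) (E : Finset α)
    (f : Finset α → ℝ) :
    bernExp p E (fun S => f S ^ 2) - bernExp p E f ^ 2 ≤
      ∑ e ∈ E, p * bernExp p E fun S => (f (insert e S) - f (S.erase e)) ^ 2 := by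
  induction E using Finset.induction_on generalizing f with
  | empty => simp [bernExp_empty]
  | insert e E he ih =>
    have i0 := ih f
    have i1 := ih fun S => f (insert e S)
    have hsq := sq_bernExp_le h0 h1 E fun S => f (insert e S) - f S
    have hsub : bernExp p E (fun S => f (insert e S) - f S) =
        bernExp p E (fun S => f (insert e S)) - bernExp p E f := by
      have := bernExp_add p E (fun S => f (insert e S) - f S) f
      simp only [sub_add_cancel] at this
      linarith
    rw [hsub] at hsq
    rw [Finset.sum_insert he, bernExp_insert p he, bernExp_insert p he, bernExp_insert p he]
    have e0 : bernExp p E (fun S => (f (insert e S) - f (S.erase e)) ^ 2) =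
        bernExp p E (fun S => (f (insert e S) - f S) ^ 2) :=
      bernExp_congr fun S hS => by rw [Finset.erase_eq_of_notMem fun h => he (hS h)]
    have e1 : bernExp p E
        (fun S => (f (insert e (insert e S)) - f ((insert e S).erase e)) ^ 2) =
        bernExp p E (fun S => (f (insert e S) - f S) ^ 2) :=
      bernExp_congr fun S hS => by
        rw [Finset.insert_idem, Finset.erase_insert fun h => he (hS h)]
    rw [e0, e1]
    have e2 : ∑ x ∈ E, p * bernExp p (insert e E)
          (fun S => (f (insert x S) - f (S.erase x)) ^ 2) =
        (1 - p) * ∑ x ∈ E, p * bernExp p E (fun S => (f (insert x S) - f (S.erase x)) ^ 2) +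
        p * ∑ x ∈ E, p * bernExp p E
          (fun S => (f (insert e (insert x S)) - f (insert e (S.erase x))) ^ 2) := by
      rw [Finset.mul_sum, Finset.mul_sum, ← Finset.sum_add_distrib]
      refine Finset.sum_congr rfl fun x hx => ?_
      have hxe : e ≠ x := fun h => he (h ▸ hx)
      rw [bernExp_insert p he]
      have : (fun S : Finset α =>
          (f (insert x (insert e S)) - f ((insert e S).erase x)) ^ 2) =
          fun S => (f (insert e (insert x S)) - f (insert e (S.erase x))) ^ 2 := by
        ext S
        rw [Finset.insert_comm, Finset.erase_insert_of_ne hxe]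
      rw [this]
      ring
    rw [e2]
    set A := bernExp p E fun S => f S ^ 2
    set B := bernExp p E fun S => f (insert e S) ^ 2
    set a := bernExp p E f
    set b := bernExp p E fun S => f (insert e S)
    set D := bernExp p E fun S => (f (insert e S) - f S) ^ 2
    have k0 := mul_le_mul_of_nonneg_left i0 (sub_nonneg.2 h1)
    have k1 := mul_le_mul_of_nonneg_left i1 h0
    have hD : 0 ≤ D := (sq_nonneg _).trans hsq
    -- Law of total variance: conditioning on `e` leaves the two conditional variances, bounded by
    -- induction, and the between-part `p (1 - p) (b - a)²`. Jensen bounds the latter by `p D`,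
    -- dropping the factor `1 - p`.
    have k2 : p * (1 - p) * (b - a) ^ 2 ≤ p * D :=
      mul_le_mul (by nlinarith) hsq (sq_nonneg _) h0
    nlinarith

/-- Chebyshev's inequality for the lower tail. -/
theorem bernExp_chebyshev {p : ℝ} (h0 : 0 ≤ p) (h1 : p ≤ 1) (E : Finset α)
    (f : Finset α → ℝ) {δ : ℝ} (hδ : 0 < δ) :
    bernExp p E (Set.indicator {S | f S + δ ≤ bernExp p E f} 1) ≤
      (bernExp p E (fun S => f S ^ 2) - bernExp p E f ^ 2) / δ ^ 2 := by
  rw [le_div_iff₀ (by positivity), mul_comm, ← bernExp_const_mul]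
  calc _ ≤ bernExp p E fun S => (f S - bernExp p E f) ^ 2 := by
        refine bernExp_mono h0 h1 fun S _ => ?_
        by_cases hS : S ∈ {S | f S + δ ≤ bernExp p E f}
        · rw [Set.indicator_of_mem hS]
          have : f S + δ ≤ bernExp p E f := hS
          simp only [Pi.one_apply, mul_one]
          nlinarith
        · rw [Set.indicator_of_notMem hS, mul_zero]
          positivity
    _ = _ := by rw [bernExp_sq_sub]; ring

/-- The probability that `S` contains `F₁` and avoids `F₂`. -/
theorem bernExp_cylinder (p : ℝ) {E F₁ F₂ : Finset α} (h₁ : F₁ ⊆ E) (h₂ : F₂ ⊆ E)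
    (h : Disjoint F₁ F₂) :
    bernExp p E (Set.indicator {S | F₁ ⊆ S ∧ Disjoint F₂ S} 1) =
      p ^ F₁.card * (1 - p) ^ F₂.card := by
  classical
  -- Expanding the product over subsets `S` gives the Bernoulli weight of `S` when `S` lies in the
  -- cylinder; otherwise a zero factor kills the term.
  have key := Finset.prod_add (fun e => if e ∈ F₂ then 0 else p)
    (fun e => if e ∈ F₁ then 0 else 1 - p) E
  have hl : ∏ e ∈ E, ((if e ∈ F₂ then 0 else p) + (if e ∈ F₁ then 0 else 1 - p)) =
      p ^ F₁.card * (1 - p) ^ F₂.card := by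
    have : ∀ e ∈ E, ((if e ∈ F₂ then 0 else p) + (if e ∈ F₁ then 0 else 1 - p)) =
        (if e ∈ F₁ then p else 1) * (if e ∈ F₂ then 1 - p else 1) := by
      intro e _
      by_cases e1 : e ∈ F₁ <;> by_cases e2 : e ∈ F₂
      · exact absurd e2 (Finset.disjoint_left.1 h e1)
      all_goals simp [e1, e2]
    rw [Finset.prod_congr rfl this, Finset.prod_mul_distrib, Finset.prod_ite_mem,
      Finset.prod_ite_mem, Finset.inter_eq_right.2 h₁, Finset.inter_eq_right.2 h₂]
    simp
  rw [← hl, key, bernExp]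
  refine Finset.sum_congr rfl fun S hS => ?_
  have hSE := Finset.mem_powerset.1 hS
  by_cases hmem : F₁ ⊆ S ∧ Disjoint F₂ S
  · rw [Set.indicator_of_mem (by exact hmem),
      Finset.prod_congr (s₁ := S) rfl (g := fun _ => p),
      Finset.prod_congr (s₁ := E \ S) rfl (g := fun _ => 1 - p)]
    · simp
    · intro e he
      rw [if_neg fun h' => (Finset.mem_sdiff.1 he).2 (hmem.1 h')]
    · intro e he
      rw [if_neg fun h' => Finset.disjoint_left.1 hmem.2 h' he]
  · rw [Set.indicator_of_notMem (by exact hmem), mul_zero, eq_comm]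
    rw [not_and_or] at hmem
    rcases hmem with hm | hm
    · obtain ⟨e, he, heS⟩ := Finset.not_subset.1 hm
      have : ∏ i ∈ E \ S, (if i ∈ F₁ then 0 else 1 - p) = 0 :=
        Finset.prod_eq_zero (Finset.mem_sdiff.2 ⟨h₁ he, heS⟩) (if_pos he)
      rw [this, mul_zero]
    · obtain ⟨e, he, heS⟩ := Finset.not_disjoint_iff.1 hm
      have : ∏ i ∈ S, (if i ∈ F₂ then 0 else p) = 0 := Finset.prod_eq_zero heS (if_pos he)
      rw [this, zero_mul]

end BernoulliSubsets

/-- The probability of an event for the percolated graph, as a finite sum. -/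
theorem percolation_real_eq {V : Type*} [Fintype V] [DecidableEq V] (G : SimpleGraph V)
    [DecidableRel G.Adj] (p : I) (A : Set (SimpleGraph V)) :
    (percolation G p).real A =
      bernExp (p : ℝ) G.edgeFinset
        (Set.indicator {S | SimpleGraph.fromEdgeSet (S : Set (Sym2 V)) ∈ A} 1) := by
  have hA : MeasurableSet A :=
    SimpleGraph.measurableEmbedding_edgeSet.measurableSet_image.1 (Set.toFinite _).measurableSet
  have hf : Measurable (SimpleGraph.fromEdgeSet : Set (Sym2 V) → SimpleGraph V) :=
    SimpleGraph.measurable_fromEdgeSet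
  rw [percolation, measureReal_def, Measure.map_apply hf hA, setBernoulli_apply_eq_apply_subsets,
    ← measureReal_def]
  classical
  set B : Finset (Finset (Sym2 V)) :=
    G.edgeFinset.powerset.filter fun S => SimpleGraph.fromEdgeSet (S : Set (Sym2 V)) ∈ A
  have hB : {s ∈ SimpleGraph.fromEdgeSet ⁻¹' A | s ⊆ G.edgeSet} =
      ⋃ S ∈ B, {(S : Set (Sym2 V))} := by
    ext s
    simp only [Set.mem_ofPred_eq, Set.mem_preimage, Set.mem_iUnion, Set.mem_singleton_iff, B,
      Finset.mem_filter, Finset.mem_powerset, exists_prop]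
    constructor
    · rintro ⟨h1, h2⟩
      refine ⟨s.toFinite.toFinset, ⟨?_, by simpa using h1⟩, by simp⟩
      intro e he
      simpa using h2 (by simpa using he)
    · rintro ⟨S, ⟨h1, h2⟩, rfl⟩
      exact ⟨h2, fun e he => by simpa using h1 he⟩
  rw [hB, measureReal_biUnion_finset]
  · rw [bernExp, Finset.sum_filter]
    refine Finset.sum_congr rfl fun S hS => ?_
    have hSE : (S : Set (Sym2 V)) ⊆ G.edgeSet := by
      rw [← SimpleGraph.coe_edgeFinset]
      exact_mod_cast Finset.mem_powerset.1 hS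
    by_cases h : SimpleGraph.fromEdgeSet (S : Set (Sym2 V)) ∈ A
    · rw [if_pos h, Set.indicator_of_mem (by exact h),
        setBernoulli_real_singleton p hSE (Set.toFinite _), ← SimpleGraph.coe_edgeFinset,
        ← Finset.coe_sdiff, Set.ncard_coe_finset, Set.ncard_coe_finset]
      simp
    · rw [if_neg h, Set.indicator_of_notMem (by exact h), mul_zero]
  · intro S _ S' _ hne
    simpa using fun h => hne (by exact_mod_cast h)
  · intro S _
    exact MeasurableSet.of_discrete

/-! ### Truncated family trees -/

section Truncation

open Classical in
/-- The offspring numbers of the first `r` generations, put to zero elsewhere. -/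
noncomputable def truncOffspring (r : ℕ) (N : List ℕ → ℕ) (u : List ℕ) : ℕ :=
  if IsGWVertex N u ∧ u.length < r then N u else 0

theorem truncOffspring_of_mem {r : ℕ} {N : List ℕ → ℕ} {u : List ℕ} (hu : IsGWVertex N u)
    (hr : u.length < r) : truncOffspring r N u = N u :=
  if_pos ⟨hu, hr⟩

theorem isGWVertex_truncOffspring {r : ℕ} {N : List ℕ → ℕ} {u : List ℕ} (hr : u.length ≤ r) :
    IsGWVertex (truncOffspring r N) u ↔ IsGWVertex N u := by
  induction u with
  | nil => exact Iff.rfl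
  | cons i u ih =>
    have hr' : u.length < r := by simpa using hr
    simp only [IsGWVertex, ih hr'.le]
    exact and_congr_right fun h => by rw [truncOffspring_of_mem h hr']

/-- Fixed points of the truncation are the canonical codes of plane trees of height at most `r`. -/
theorem truncOffspring_truncOffspring (r : ℕ) (N : List ℕ → ℕ) :
    truncOffspring r (truncOffspring r N) = truncOffspring r N := by
  ext u
  by_cases h : IsGWVertex N u ∧ u.length < r
  · exact truncOffspring_of_mem ((isGWVertex_truncOffspring h.2.le).2 h.1) h.2
  · rw [truncOffspring, if_neg]
    · rw [truncOffspring, if_neg h]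
    · exact fun h' => h ⟨(isGWVertex_truncOffspring h'.2.le).1 h'.1, h'.2⟩

theorem isGWVertex_length_lt {r : ℕ} {τ : List ℕ → ℕ} (hτ : truncOffspring r τ = τ)
    {u : List ℕ} (h : τ u ≠ 0) : IsGWVertex τ u ∧ u.length < r := by
  by_contra h'
  rw [← hτ, truncOffspring, if_neg h'] at h
  exact h rfl

/-- The vertices of the first `r` generations of the family tree. -/
noncomputable def treeVerts (τ : List ℕ → ℕ) (r : ℕ) : Finset (List ℕ) :=
  (finite_gwGenerations τ r).toFinset

@[simp]
theorem mem_treeVerts {τ : List ℕ → ℕ} {r : ℕ} {u : List ℕ} :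
    u ∈ treeVerts τ r ↔ IsGWVertex τ u ∧ u.length ≤ r := by
  simp [treeVerts]

end Truncation

/-! ### Charts identifying a ball with a tree -/

/-- One of the words `u` and `w` is the parent of the other one. -/
def TreeAdj (u w : List ℕ) : Prop := (∃ i, u = i :: w) ∨ (∃ i, w = i :: u)

theorem TreeAdj.length_le {u w : List ℕ} (h : TreeAdj u w) : w.length ≤ u.length + 1 := by
  rcases h with ⟨i, rfl⟩ | ⟨i, rfl⟩ <;> simp
  omega

/-- The map `φ` identifies the first `r` generations of the family tree with offspring numbers `τ`
with the ball of radius `r` around `v` in the graph `H`. -/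
structure IsBallChart {V : Type*} (H : SimpleGraph V) (τ : List ℕ → ℕ) (r : ℕ) (v : V)
    (φ : List ℕ → V) : Prop where
  root : φ [] = v
  injOn : Set.InjOn φ (treeVerts τ r)
  adj_iff : ∀ u ∈ treeVerts τ r, ∀ w ∈ treeVerts τ r, (H.Adj (φ u) (φ w) ↔ TreeAdj u w)
  closed : ∀ u ∈ treeVerts τ r, u.length < r → ∀ y, H.Adj (φ u) y → ∃ w ∈ treeVerts τ r, y = φ w

namespace IsBallChart

variable {V : Type*} {H : SimpleGraph V} {τ : List ℕ → ℕ} {r : ℕ} {v : V} {φ : List ℕ → V}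

/-- Each step of a walk from a vertex of depth less than `r` stays in the image by `closed` and
raises the depth by at most one, so the remaining length is a sufficient budget. -/
theorem mem_of_walk (h : IsBallChart H τ r v φ) {x y : V} (p : H.Walk x y) :
    ∀ u ∈ treeVerts τ r, x = φ u → u.length + p.length ≤ r →
      ∃ w ∈ treeVerts τ r, y = φ w := by
  induction p with
  | nil => exact fun u hu hx _ => ⟨u, hu, hx⟩
  | cons hadj p ih =>
    rintro u hu rfl hlen
    rw [SimpleGraph.Walk.length_cons] at hlen
    obtain ⟨w, hw, rfl⟩ := h.closed u hu (by omega) _ hadj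
    have := ((h.adj_iff u hu w hw).1 hadj).length_le
    exact ih w hw rfl (by omega)

theorem edist_le (h : IsBallChart H τ r v φ) {u : List ℕ} (hu : u ∈ treeVerts τ r) :
    H.edist v (φ u) ≤ u.length := by
  induction u with
  | nil => simp [h.root]
  | cons i u ih =>
    have hu' : u ∈ treeVerts τ r := by
      rw [mem_treeVerts] at hu ⊢
      exact ⟨hu.1.1, (Nat.le_succ _).trans hu.2⟩
    have hadj : H.Adj (φ u) (φ (i :: u)) := (h.adj_iff u hu' _ hu).2 (Or.inr ⟨i, rfl⟩)
    calc H.edist v (φ (i :: u)) ≤ H.edist v (φ u) + H.edist (φ u) (φ (i :: u)) :=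
          H.edist_triangle
      _ ≤ (u.length : ℕ∞) + 1 := by
          refine add_le_add (ih hu') ?_
          simpa using SimpleGraph.edist_le hadj.toWalk
      _ = ((i :: u).length : ℕ∞) := by simp

theorem mem_closedNbhd_iff (h : IsBallChart H τ r v φ) {y : V} :
    y ∈ closedNbhd H v r ↔ ∃ w ∈ treeVerts τ r, y = φ w := by
  constructor
  · intro hy
    obtain ⟨p, hp⟩ := SimpleGraph.exists_walk_of_edist_ne_top
      (ne_top_of_le_ne_top (ENat.natCast_ne_top r) hy)
    have h2 : p.length ≤ r := by
      have : (p.length : ℕ∞) ≤ r := hp ▸ hy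
      exact_mod_cast this
    exact h.mem_of_walk p [] (by simp [IsGWVertex]) h.root.symm (by simpa using h2)
  · rintro ⟨w, hw, rfl⟩
    exact (h.edist_le hw).trans (by exact_mod_cast (mem_treeVerts.1 hw).2)

/-- On the first `r` generations the chart is a rooted isomorphism onto the ball; surjectivity is
`mem_closedNbhd_iff`. -/
theorem ballClass_eq (h : IsBallChart H τ r v φ) [Finite (closedNbhd H v r)] :
    ballClass H v r = ballClass (gwTree τ) (gwRoot τ) r := by
  symm
  refine (rootedClass_eq_mk_iff _ _ _).2 ?_
  have hmem (u : closedNbhd (gwTree τ) (gwRoot τ) r) : u.1.1 ∈ treeVerts τ r :=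
    mem_treeVerts.2 ⟨u.1.2, mem_closedNbhd_gwTree.1 u.2⟩
  let f : closedNbhd (gwTree τ) (gwRoot τ) r → closedNbhd H v r :=
    fun u => ⟨φ u.1.1, h.mem_closedNbhd_iff.2 ⟨_, hmem u, rfl⟩⟩
  have hf : Function.Bijective f := by
    constructor
    · intro u w huw
      exact Subtype.ext (Subtype.ext (h.injOn (hmem u) (hmem w) (congrArg Subtype.val huw)))
    · rintro ⟨y, hy⟩
      obtain ⟨w, hw, rfl⟩ := h.mem_closedNbhd_iff.1 hy
      have hw' := mem_treeVerts.1 hw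
      exact ⟨⟨⟨w, hw'.1⟩, mem_closedNbhd_gwTree.2 hw'.2⟩, rfl⟩
  let ψ : ballGraph (gwTree τ) (gwRoot τ) r ≃g ballGraph H v r :=
    ⟨Equiv.ofBijective f hf, fun {u w} => h.adj_iff _ (hmem u) _ (hmem w)⟩
  obtain ⟨χ, hχ⟩ := (rootedClass_eq_mk_iff (ballGraph H v r) (ballRoot H v r) _).1 rfl
  refine ⟨ψ.trans χ, ?_⟩
  rw [← hχ]
  exact congrArg χ (Subtype.ext h.root)

/-- A chart only depends on the edges that meet its image. -/
theorem congr_graph (h : IsBallChart H τ r v φ) {H' : SimpleGraph V}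
    (hadj : ∀ u ∈ treeVerts τ r, ∀ y, (H.Adj (φ u) y ↔ H'.Adj (φ u) y)) :
    IsBallChart H' τ r v φ where
  root := h.root
  injOn := h.injOn
  adj_iff u hu w hw := by rw [← hadj u hu]; exact h.adj_iff u hu w hw
  closed u hu hr y hy := h.closed u hu hr y ((hadj u hu y).2 hy)

theorem adj_cases (h : IsBallChart H τ r v φ) {u : List ℕ} (hu : u ∈ treeVerts τ r)
    (hr : u.length < r) {y : V} (hy : H.Adj (φ u) y) :
    (u ≠ [] ∧ y = φ u.tail) ∨ ∃ i < τ u, y = φ (i :: u) := by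
  obtain ⟨w, hw, rfl⟩ := h.closed u hu hr y hy
  rcases (h.adj_iff u hu w hw).1 hy with ⟨i, rfl⟩ | ⟨i, rfl⟩
  · exact Or.inl ⟨by simp, rfl⟩
  · exact Or.inr ⟨i, (mem_treeVerts.1 hw).1.2, rfl⟩

theorem degree_le [Fintype V] [DecidableEq V] [DecidableRel H.Adj] (h : IsBallChart H τ r v φ)
    {u : List ℕ} (hu : u ∈ treeVerts τ r) (hr : u.length < r) :
    H.degree (φ u) ≤ τ u + 1 := by
  have : H.neighborFinset (φ u) ⊆
      insert (φ u.tail) ((Finset.range (τ u)).image fun i => φ (i :: u)) := by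
    intro y hy
    rw [SimpleGraph.mem_neighborFinset] at hy
    rcases h.adj_cases hu hr hy with ⟨-, rfl⟩ | ⟨i, hi, rfl⟩
    · exact Finset.mem_insert_self _ _
    · exact Finset.mem_insert_of_mem (Finset.mem_image.2 ⟨i, Finset.mem_range.2 hi, rfl⟩)
  calc H.degree (φ u) ≤ _ := Finset.card_le_card this
    _ ≤ _ := Finset.card_insert_le _ _
    _ ≤ τ u + 1 := by
      have := Finset.card_image_le (s := Finset.range (τ u)) (f := fun i => φ (i :: u))
      rw [Finset.card_range] at this
      omega

end IsBallChart

/-- Truncating the offspring numbers does not change the ball around the root. -/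
theorem ballClass_gwTree_truncOffspring (r : ℕ) (N : List ℕ → ℕ) :
    ballClass (gwTree N) (gwRoot N) r =
      ballClass (gwTree (truncOffspring r N)) (gwRoot (truncOffspring r N)) r := by
  classical
  have hT {u : List ℕ} (hu : u ∈ treeVerts (truncOffspring r N) r) : IsGWVertex N u := by
    rw [mem_treeVerts] at hu
    exact (isGWVertex_truncOffspring hu.2).1 hu.1
  -- The identity on words is a chart of the untruncated tree; the root is a junk value off the
  -- tree.
  let φ : List ℕ → {u : List ℕ // IsGWVertex N u} :=
    fun u => if h : IsGWVertex N u then ⟨u, h⟩ else gwRoot N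
  have hφ {u : List ℕ} (h : IsGWVertex N u) : φ u = ⟨u, h⟩ := dif_pos h
  have hroot : φ [] = gwRoot N := hφ (u := []) trivial
  refine IsBallChart.ballClass_eq (φ := φ) ⟨hroot, ?_, ?_, ?_⟩
  · intro u hu w hw huw
    rw [hφ (hT hu), hφ (hT hw)] at huw
    exact congrArg Subtype.val huw
  · intro u hu w hw
    rw [hφ (hT hu), hφ (hT hw)]
    exact Iff.rfl
  · intro u hu hr y hy
    rw [hφ (hT hu)] at hy
    refine ⟨y.1, mem_treeVerts.2 ?_, (hφ y.2).symm⟩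
    have hl : y.1.length ≤ r := (TreeAdj.length_le hy).trans hr
    exact ⟨(isGWVertex_truncOffspring hl).2 y.2, hl⟩

/-! ### Ordered charts and their uniqueness -/

theorem eq_of_strictMonoOn_of_image_eq {V : Type*} [LinearOrder V] {a b : ℕ → V} {n m : ℕ}
    (ha : ∀ i j, i < j → j < n → a i < a j) (hb : ∀ i j, i < j → j < m → b i < b j)
    (h : ∀ y, (∃ i < n, y = a i) ↔ ∃ i < m, y = b i) : n = m ∧ ∀ i < n, a i = b i := by
  have inj {a : ℕ → V} {n : ℕ} (ha : ∀ i j, i < j → j < n → a i < a j) :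
      Set.InjOn a (Finset.range n) := by
    intro i hi j hj hij
    simp only [Finset.coe_range, Set.mem_Iio] at hi hj
    rcases lt_trichotomy i j with h | h | h
    · exact absurd hij (ha i j h hj).ne
    · exact h
    · exact absurd hij (ha j i h hi).ne'
  have himg : (Finset.range n).image a = (Finset.range m).image b := by
    ext y
    simpa [eq_comm] using h y
  have hnm : n = m := by
    have := congrArg Finset.card himg
    rwa [Finset.card_image_of_injOn (inj ha), Finset.card_image_of_injOn (inj hb),
      Finset.card_range, Finset.card_range] at this
  subst hnm
  refine ⟨rfl, ?_⟩
  have key : (fun i : Fin n => a i) = fun i : Fin n => b i := by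
    have ha' : StrictMono fun i : Fin n => a i := fun i j hij => ha i j hij j.2
    have hb' : StrictMono fun i : Fin n => b i := fun i j hij => hb i j hij j.2
    refine (ha'.range_inj hb').1 ?_
    ext y
    constructor
    · rintro ⟨i, rfl⟩
      obtain ⟨j, hj, e⟩ := (h _).1 ⟨i, i.2, rfl⟩
      exact ⟨⟨j, hj⟩, e.symm⟩
    · rintro ⟨i, rfl⟩
      obtain ⟨j, hj, e⟩ := (h _).2 ⟨i, i.2, rfl⟩
      exact ⟨⟨j, hj⟩, e.symm⟩
  exact fun i hi => congrFun key ⟨i, hi⟩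

/-- A chart for which the children of every vertex appear in increasing order. -/
structure IsOrderedChart {V : Type*} [LinearOrder V] (H : SimpleGraph V) (τ : List ℕ → ℕ) (r : ℕ)
    (v : V) (φ : List ℕ → V) : Prop extends IsBallChart H τ r v φ where
  mono : ∀ u ∈ treeVerts τ r, u.length < r → ∀ i j, i < j → j < τ u → φ (i :: u) < φ (j :: u)

namespace IsOrderedChart

variable {V : Type*} [LinearOrder V] {H : SimpleGraph V} {τ τ' : List ℕ → ℕ} {r : ℕ} {v : V}
  {φ φ' : List ℕ → V}

theorem children_iff (h : IsOrderedChart H τ r v φ) {u : List ℕ} (hu : u ∈ treeVerts τ r)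
    (hr : u.length < r) (y : V) :
    (∃ i < τ u, y = φ (i :: u)) ↔ H.Adj (φ u) y ∧ (u ≠ [] → y ≠ φ u.tail) := by
  have hu' := mem_treeVerts.1 hu
  constructor
  · rintro ⟨i, hi, rfl⟩
    have hi' : i :: u ∈ treeVerts τ r := mem_treeVerts.2 ⟨⟨hu'.1, hi⟩, hr⟩
    refine ⟨(h.adj_iff u hu _ hi').2 (Or.inr ⟨i, rfl⟩), fun hne heq => ?_⟩
    have ht : u.tail ∈ treeVerts τ r := by
      cases u with
      | nil => exact hu
      | cons j u => exact mem_treeVerts.2 ⟨hu'.1.1, (Nat.le_succ _).trans hu'.2⟩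
    have := congrArg List.length (h.injOn hi' ht heq)
    simp only [List.length_cons, List.length_tail] at this
    omega
  · rintro ⟨hadj, hne⟩
    rcases h.adj_cases hu hr hadj with ⟨h1, h2⟩ | h1
    · exact absurd h2 (hne h1)
    · exact h1

/-- Induction from the root. If the charts agree at `u` and at its parent, the children of `u` are
in both cases the neighbours of `φ u` other than the parent, and the increasing order leaves no
freedom. The parent `u.tail` is carried in the statement because it must be removed from the
neighbours; at the root there is nothing to remove. -/
theorem agree (h : IsOrderedChart H τ r v φ) (h' : IsOrderedChart H τ' r v φ') (u : List ℕ) :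
    u ∈ treeVerts τ r → u ∈ treeVerts τ' r ∧ φ u = φ' u ∧ φ u.tail = φ' u.tail ∧
      (u.length < r → τ u = τ' u ∧ ∀ i < τ u, φ (i :: u) = φ' (i :: u)) := by
  have step {u : List ℕ} (hu : u ∈ treeVerts τ r) (hu' : u ∈ treeVerts τ' r)
      (e : φ u = φ' u) (e' : φ u.tail = φ' u.tail) (hr : u.length < r) :
      τ u = τ' u ∧ ∀ i < τ u, φ (i :: u) = φ' (i :: u) := by
    refine eq_of_strictMonoOn_of_image_eq (h.mono u hu hr) (h'.mono u hu' hr) fun y => ?_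
    rw [h.children_iff hu hr, h'.children_iff hu' hr, e, e']
  induction u with
  | nil =>
    intro hu
    have hu' : [] ∈ treeVerts τ' r := by simp [IsGWVertex]
    have e : φ [] = φ' [] := h.root.trans h'.root.symm
    exact ⟨hu', e, e, step hu hu' e e⟩
  | cons i u ih =>
    intro hi
    have hi' := mem_treeVerts.1 hi
    have hr : u.length < r := hi'.2
    have hu : u ∈ treeVerts τ r := mem_treeVerts.2 ⟨hi'.1.1, hr.le⟩
    obtain ⟨hu', e, -, hs⟩ := ih hu
    obtain ⟨hs1, hs2⟩ := hs hr
    have hi'' : i :: u ∈ treeVerts τ' r :=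
      mem_treeVerts.2 ⟨⟨(mem_treeVerts.1 hu').1, hs1 ▸ hi'.1.2⟩, hr⟩
    have e' := hs2 i hi'.1.2
    exact ⟨hi'', e', e, step hi hi'' e' e⟩

/-- Makes the events of different plane trees disjoint. Truncated codes vanish off the inner
vertices, and there the charts agree. -/
theorem offspring_unique (h : IsOrderedChart H τ r v φ) (h' : IsOrderedChart H τ' r v φ')
    (hτ : truncOffspring r τ = τ) (hτ' : truncOffspring r τ' = τ') : τ = τ' := by
  ext u
  by_cases hu : τ u = 0
  · by_cases hu' : τ' u = 0
    · rw [hu, hu']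
    · have := isGWVertex_length_lt hτ' hu'
      exact (((h'.agree h u (mem_treeVerts.2 ⟨this.1, this.2.le⟩)).2.2.2 this.2).1).symm
  · have := isGWVertex_length_lt hτ hu
    exact ((h.agree h' u (mem_treeVerts.2 ⟨this.1, this.2.le⟩)).2.2.2 this.2).1

theorem congr_graph (h : IsOrderedChart H τ r v φ) {H' : SimpleGraph V}
    (hadj : ∀ u ∈ treeVerts τ r, ∀ y, (H.Adj (φ u) y ↔ H'.Adj (φ u) y)) :
    IsOrderedChart H' τ r v φ :=
  ⟨h.toIsBallChart.congr_graph hadj, h.mono⟩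

end IsOrderedChart

/-! ### Roots that a given vertex can influence -/

section Reach

variable {V : Type*} [Fintype V] [DecidableEq V] (H : SimpleGraph V) [DecidableRel H.Adj]

/-- The vertices that can be reached from `x` by at most `j + 1` steps, all of which except the
first one start at a vertex of degree at most `D`. -/
def boundedReach (D : ℕ) (x : V) : ℕ → Finset V
  | 0 => insert x (H.neighborFinset x)
  | j + 1 => boundedReach D x j ∪
      ((boundedReach D x j).filter fun y => H.degree y ≤ D).biUnion fun y => H.neighborFinset y

theorem card_boundedReach_le (D : ℕ) (x : V) (j : ℕ) :
    (boundedReach H D x j).card ≤ (H.degree x + 1) * (D + 1) ^ j := by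
  induction j with
  | zero => simp [boundedReach]
  | succ j ih =>
    rw [boundedReach]
    calc _ ≤ (boundedReach H D x j).card + _ := Finset.card_union_le _ _
      _ ≤ (boundedReach H D x j).card + (boundedReach H D x j).card * D := by
          refine Nat.add_le_add_left ((Finset.card_biUnion_le_card_mul _ _ D ?_).trans
            (Nat.mul_le_mul_right _ (Finset.card_filter_le _ _))) _
          intro y hy
          exact (Finset.mem_filter.1 hy).2
      _ = (boundedReach H D x j).card * (D + 1) := by ring
      _ ≤ (H.degree x + 1) * (D + 1) ^ j * (D + 1) := Nat.mul_le_mul_right _ ih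
      _ = _ := by ring

variable {H}

/-- Climb from `u` through its ancestors. Every vertex left after the first step has depth less than
`r`, hence degree at most `Δ + 1`. Only `φ u` itself may have depth `r`, where the degree is
uncontrolled; this is why the first step is exempt from the degree condition. -/
theorem IsBallChart.root_mem_boundedReach {τ : List ℕ → ℕ} {r : ℕ} {v : V} {φ : List ℕ → V}
    (h : IsBallChart H τ r v φ) {Δ : ℕ} (hΔ : ∀ u, τ u ≤ Δ) {u : List ℕ}
    (hu : u ∈ treeVerts τ r) : v ∈ boundedReach H (Δ + 1) (φ u) r := by
  have hdrop (k : ℕ) : u.drop k ∈ treeVerts τ r := by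
    induction k with
    | zero => exact hu
    | succ k ih =>
      rw [← List.tail_drop]
      generalize u.drop k = w at ih
      have hw := mem_treeVerts.1 ih
      cases w with
      | nil => exact ih
      | cons j w => exact mem_treeVerts.2 ⟨hw.1.1, (Nat.le_succ _).trans hw.2⟩
  have key (k : ℕ) : φ (u.drop k) ∈ boundedReach H (Δ + 1) (φ u) k := by
    induction k with
    | zero => exact Finset.mem_insert_self _ _
    | succ k ih =>
      rw [boundedReach]
      have h1 := hdrop k
      have h2 := hdrop (k + 1)
      rw [← List.tail_drop] at h2 ⊢
      by_cases hnil : u.drop k = []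
      · rw [hnil] at ih ⊢
        exact Finset.mem_union_left _ ih
      have hadj : H.Adj (φ (u.drop k)) (φ (u.drop k).tail) := by
        refine (h.adj_iff _ h1 _ h2).2 (Or.inl ⟨(u.drop k).head hnil, ?_⟩)
        exact (List.cons_head_tail hnil).symm
      cases k with
      | zero =>
        refine Finset.mem_union_left _ (Finset.mem_insert_of_mem ?_)
        simpa using hadj
      | succ k =>
        refine Finset.mem_union_right _ (Finset.mem_biUnion.2
          ⟨_, Finset.mem_filter.2 ⟨ih, ?_⟩, (H.mem_neighborFinset _ _).2 hadj⟩)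
        have hlen : (u.drop (k + 1)).length < r := by
          have h3 := (mem_treeVerts.1 hu).2
          have h4 := List.length_pos_iff.2 hnil
          rw [List.length_drop] at h4 ⊢
          omega
        exact (h.degree_le h1 hlen).trans (Nat.add_le_add_right (hΔ _) 1)
  have := key r
  rwa [List.drop_eq_nil_of_le (mem_treeVerts.1 hu).2, h.root] at this

end Reach

/-! ### Counting embedded plane trees in a regular graph -/

/-- The vertices of the first `r - 1` generations of the family tree. -/
noncomputable def innerVerts (τ : List ℕ → ℕ) (r : ℕ) : Finset (List ℕ) :=
  (treeVerts τ r).filter fun u => u.length < r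

theorem mem_innerVerts {τ : List ℕ → ℕ} {r : ℕ} {u : List ℕ} :
    u ∈ innerVerts τ r ↔ IsGWVertex τ u ∧ u.length < r := by
  rw [innerVerts, Finset.mem_filter, mem_treeVerts]
  exact ⟨fun h => ⟨h.1.1, h.2⟩, fun h => ⟨⟨h.1, h.2.le⟩, h.2⟩⟩

theorem innerVerts_subset (τ : List ℕ → ℕ) (r : ℕ) : innerVerts τ r ⊆ treeVerts τ r :=
  Finset.filter_subset _ _

/-- The root and the children of the vertices in `J`. -/
def childVerts (τ : List ℕ → ℕ) (J : Finset (List ℕ)) : Finset (List ℕ) :=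
  insert [] (J.biUnion fun u => (Finset.range (τ u)).image fun i => i :: u)

theorem nil_mem_childVerts (τ : List ℕ → ℕ) (J : Finset (List ℕ)) : [] ∈ childVerts τ J :=
  Finset.mem_insert_self _ _

theorem cons_mem_childVerts {τ : List ℕ → ℕ} {J : Finset (List ℕ)} {i : ℕ} {u : List ℕ} :
    i :: u ∈ childVerts τ J ↔ u ∈ J ∧ i < τ u := by
  simp [childVerts]

theorem childVerts_mono (τ : List ℕ → ℕ) {J J' : Finset (List ℕ)} (h : J ⊆ J') :
    childVerts τ J ⊆ childVerts τ J' :=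
  Finset.insert_subset_insert _ (Finset.biUnion_subset_biUnion_of_subset_left _ h)

theorem childVerts_innerVerts (τ : List ℕ → ℕ) (r : ℕ) :
    childVerts τ (innerVerts τ r) = treeVerts τ r := by
  ext u
  cases u with
  | nil => simp [nil_mem_childVerts, IsGWVertex]
  | cons i u =>
    rw [cons_mem_childVerts, mem_innerVerts, mem_treeVerts, IsGWVertex, List.length_cons,
      Nat.succ_le_iff]
    tauto

/-- Every vertex other than the root is a child of exactly one inner vertex. -/
theorem card_treeVerts_eq (τ : List ℕ → ℕ) (r : ℕ) :
    (treeVerts τ r).card = ∑ u ∈ innerVerts τ r, τ u + 1 := by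
  rw [← childVerts_innerVerts, childVerts, Finset.card_insert_of_notMem (by simp),
    Finset.card_biUnion]
  · congr 1
    refine Finset.sum_congr rfl fun u _ => ?_
    rw [Finset.card_image_of_injective _ fun i j h => (List.cons.inj h).1, Finset.card_range]
  · intro u _ w _ huw
    refine Finset.disjoint_left.2 fun x hx hx' => huw ?_
    obtain ⟨i, -, rfl⟩ := Finset.mem_image.1 hx
    obtain ⟨j, -, h⟩ := Finset.mem_image.1 hx'
    exact (List.cons.inj h).2.symm

section Counting

variable {V : Type*} [LinearOrder V]

/-- An embedding of the root and of the children of the vertices in `J` in the graph `G`, for which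
the children of every vertex appear in increasing order. -/
structure IsPreChart (G : SimpleGraph V) (τ : List ℕ → ℕ) (J : Finset (List ℕ)) (v : V)
    (φ : List ℕ → V) : Prop where
  root : φ [] = v
  injOn : Set.InjOn φ (childVerts τ J)
  adj : ∀ u ∈ J, ∀ i < τ u, G.Adj (φ u) (φ (i :: u))
  mono : ∀ u ∈ J, ∀ i j, i < j → j < τ u → φ (i :: u) < φ (j :: u)

/-- The modification of `φ` that maps the first children of `a` to the elements of `s`, in
increasing order. -/
def extendChart (φ : List ℕ → V) (a : List ℕ) (s : Finset V) : List ℕ → V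
  | [] => φ []
  | i :: u => if h : u = a ∧ i < s.card then s.orderEmbOfFin rfl ⟨i, h.2⟩ else φ (i :: u)

theorem extendChart_child (φ : List ℕ → V) (a : List ℕ) (s : Finset V) {i : ℕ} (hi : i < s.card) :
    extendChart φ a s (i :: a) = s.orderEmbOfFin rfl ⟨i, hi⟩ :=
  dif_pos ⟨rfl, hi⟩

theorem extendChart_of_ne (φ : List ℕ → V) {a : List ℕ} (s : Finset V) {w : List ℕ}
    (h : ∀ i, w ≠ i :: a) : extendChart φ a s w = φ w := by
  cases w with
  | nil => rfl
  | cons i u => exact dif_neg fun h' => h i (by rw [h'.1])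

theorem mem_iff_extendChart (φ : List ℕ → V) (a : List ℕ) (s : Finset V) (y : V) :
    y ∈ s ↔ ∃ i < s.card, y = extendChart φ a s (i :: a) := by
  constructor
  · intro hy
    have : y ∈ Set.range (s.orderEmbOfFin rfl) := by simpa using hy
    obtain ⟨i, rfl⟩ := this
    exact ⟨i, i.2, (extendChart_child φ a s i.2).symm⟩
  · rintro ⟨i, hi, rfl⟩
    rw [extendChart_child φ a s hi]
    exact Finset.orderEmbOfFin_mem _ _ _

/-- The new children avoid everything already placed, which keeps the map injective, and sorting `s`
provides the order. Since `a ∉ J`, no earlier value is overwritten. -/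
theorem IsPreChart.extend {G : SimpleGraph V} {τ : List ℕ → ℕ} {J : Finset (List ℕ)} {v : V}
    {φ : List ℕ → V} (h : IsPreChart G τ J v φ) {a : List ℕ} (ha : a ∉ J)
    (haJ : a ∈ childVerts τ J) (hJ : ∀ u ∈ J, u ∈ childVerts τ J) {s : Finset V}
    (hcard : s.card = τ a) (hadj : ∀ y ∈ s, G.Adj (φ a) y)
    (hs : ∀ y ∈ s, y ∉ (childVerts τ J).image φ) :
    IsPreChart G τ (insert a J) v (extendChart φ a s) := by
  have hold {w : List ℕ} (hw : w ∈ childVerts τ J) : extendChart φ a s w = φ w := by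
    refine extendChart_of_ne φ s fun i hi => ha ?_
    rw [hi, cons_mem_childVerts] at hw
    exact hw.1
  have hnew {i : ℕ} (hi : i < τ a) : extendChart φ a s (i :: a) ∈ s :=
    (mem_iff_extendChart φ a s _).2 ⟨i, hcard ▸ hi, rfl⟩
  have hcases {w : List ℕ} (hw : w ∈ childVerts τ (insert a J)) :
      w ∈ childVerts τ J ∨ ∃ i < τ a, w = i :: a := by
    cases w with
    | nil => exact Or.inl (nil_mem_childVerts _ _)
    | cons i u =>
      rw [cons_mem_childVerts, Finset.mem_insert] at hw
      rcases hw with ⟨rfl | hu, hi⟩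
      · exact Or.inr ⟨i, hi, rfl⟩
      · exact Or.inl (cons_mem_childVerts.2 ⟨hu, hi⟩)
  have hmono (i j : ℕ) (hij : i < j) (hj : j < τ a) :
      extendChart φ a s (i :: a) < extendChart φ a s (j :: a) := by
    rw [extendChart_child φ a s (hcard ▸ hij.trans hj), extendChart_child φ a s (hcard ▸ hj)]
    exact (s.orderEmbOfFin rfl).strictMono hij
  have hcross {w : List ℕ} (hw : w ∈ childVerts τ J) {i : ℕ} (hi : i < τ a) :
      extendChart φ a s w ≠ extendChart φ a s (i :: a) := by
    intro heq
    refine hs _ (hnew hi) ?_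
    rw [← heq, hold hw]
    exact Finset.mem_image_of_mem _ hw
  refine ⟨h.root, ?_, ?_, ?_⟩
  · intro w hw w' hw' heq
    rcases hcases hw with hw | ⟨i, hi, rfl⟩ <;> rcases hcases hw' with hw' | ⟨j, hj, rfl⟩
    · rw [hold hw, hold hw'] at heq
      exact h.injOn hw hw' heq
    · exact absurd heq (hcross hw hj)
    · exact absurd heq.symm (hcross hw' hi)
    · rcases lt_trichotomy i j with h | rfl | h
      · exact absurd heq (hmono i j h hj).ne
      · rfl
      · exact absurd heq (hmono j i h hi).ne'
  · intro u hu i hi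
    rcases Finset.mem_insert.1 hu with rfl | hu
    · rw [hold haJ]
      exact hadj _ (hnew hi)
    · rw [hold (hJ u hu), hold (cons_mem_childVerts.2 ⟨hu, hi⟩)]
      exact h.adj u hu i hi
  · intro u hu i j hij hj
    rcases Finset.mem_insert.1 hu with rfl | hu
    · exact hmono i j hij hj
    · rw [hold (cons_mem_childVerts.2 ⟨hu, hij.trans hj⟩),
        hold (cons_mem_childVerts.2 ⟨hu, hj⟩)]
      exact h.mono u hu i j hij hj

/-- The set `s` can be read off as the image of the children of `a`, so distinct choices give
distinct embeddings and the numbers of choices multiply. -/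
theorem extendChart_inj {τ : List ℕ → ℕ} {J : Finset (List ℕ)} {a : List ℕ} (ha : a ∉ J)
    {φ φ' : List ℕ → V} {s s' : Finset V} (hs : s.card = τ a) (hs' : s'.card = τ a)
    (h : ∀ u ∈ childVerts τ (insert a J), extendChart φ a s u = extendChart φ' a s' u) :
    (∀ u ∈ childVerts τ J, φ u = φ' u) ∧ s = s' := by
  constructor
  · intro u hu
    have hne (i : ℕ) : u ≠ i :: a := by
      rintro rfl
      exact ha (cons_mem_childVerts.1 hu).1
    have hu' : u ∈ childVerts τ (insert a J) := childVerts_mono τ (Finset.subset_insert _ _) hu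
    have := h u hu'
    rwa [extendChart_of_ne φ s hne, extendChart_of_ne φ' s' hne] at this
  · ext y
    rw [mem_iff_extendChart φ a s, mem_iff_extendChart φ' a s', hs, hs']
    refine exists_congr fun i => and_congr_right fun hi => ?_
    rw [h _ (cons_mem_childVerts.2 ⟨Finset.mem_insert_self _ _, hi⟩)]

variable [Fintype V]

/-- A regular graph contains many embedded copies of a tree. -/
theorem exists_preCharts (G : SimpleGraph V) [DecidableRel G.Adj] {d : ℕ}
    (hG : G.IsRegularOfDegree d) (τ : List ℕ → ℕ) (v : V) {K : ℕ} (J : Finset (List ℕ)) :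
    (∀ i w, i :: w ∈ J → w ∈ J ∧ i < τ w) → (childVerts τ J).card ≤ K →
    ∃ Ψ : Finset (List ℕ → V), (∀ φ ∈ Ψ, IsPreChart G τ J v φ) ∧
      (∀ φ ∈ Ψ, ∀ φ' ∈ Ψ, (∀ u ∈ childVerts τ J, φ u = φ' u) → φ = φ') ∧
      ∏ u ∈ J, (d - K).choose (τ u) ≤ Ψ.card := by
  classical
  -- The longest word is added last, so the smaller set stays closed under parents and contains no
  -- child of the new vertex.
  refine Finset.induction_on_max_value List.length J ?_ ?_
  · intro _ _
    refine ⟨{fun _ => v}, ?_, by simp, by simp⟩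
    intro φ hφ
    rw [Finset.mem_singleton.1 hφ]
    exact ⟨rfl, by simp [childVerts], by simp, by simp⟩
  · intro a J ha hmax ih hcl hK
    have hcl' (i : ℕ) (w : List ℕ) (h : i :: w ∈ J) : w ∈ J ∧ i < τ w := by
      obtain ⟨h1, h2⟩ := hcl i w (Finset.mem_insert_of_mem h)
      refine ⟨(Finset.mem_insert.1 h1).resolve_left ?_, h2⟩
      rintro rfl
      have := hmax _ h
      simp at this
    have hK' : (childVerts τ J).card ≤ K :=
      (Finset.card_le_card (childVerts_mono τ (Finset.subset_insert _ _))).trans hK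
    obtain ⟨Ψ, h1, h2, h3⟩ := ih hcl' hK'
    have haJ : a ∈ childVerts τ J := by
      cases a with
      | nil => exact nil_mem_childVerts _ _
      | cons i w =>
        obtain ⟨h1, h2⟩ := hcl i w (Finset.mem_insert_self _ _)
        refine cons_mem_childVerts.2 ⟨(Finset.mem_insert.1 h1).resolve_left fun h => ?_, h2⟩
        simpa using congrArg List.length h
    have hJ : ∀ u ∈ J, u ∈ childVerts τ J := by
      intro u hu
      cases u with
      | nil => exact nil_mem_childVerts _ _
      | cons i w => exact cons_mem_childVerts.2 (hcl' i w hu)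
    -- At least `d - K` neighbours of `φ a` are unused, and any `τ a` of them can serve as children.
    let free (φ : List ℕ → V) : Finset V := G.neighborFinset (φ a) \ (childVerts τ J).image φ
    let Q : Finset (Σ _ : List ℕ → V, Finset V) :=
      Ψ.sigma fun φ => Finset.powersetCard (τ a) (free φ)
    have hQ {x : Σ _ : List ℕ → V, Finset V} (hx : x ∈ Q) :
        x.1 ∈ Ψ ∧ x.2 ⊆ free x.1 ∧ x.2.card = τ a := by
      rw [Finset.mem_sigma, Finset.mem_powersetCard] at hx
      exact hx
    have hinj {x y : Σ _ : List ℕ → V, Finset V} (hx : x ∈ Q) (hy : y ∈ Q)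
        (h : ∀ u ∈ childVerts τ (insert a J),
          extendChart x.1 a x.2 u = extendChart y.1 a y.2 u) : x = y := by
      obtain ⟨x1, -, x3⟩ := hQ hx
      obtain ⟨y1, -, y3⟩ := hQ hy
      obtain ⟨e1, e2⟩ := extendChart_inj ha x3 y3 h
      exact Sigma.ext (h2 _ x1 _ y1 e1) (heq_of_eq e2)
    refine ⟨Q.image fun x => extendChart x.1 a x.2, ?_, ?_, ?_⟩
    · intro ψ hψ
      obtain ⟨x, hx, rfl⟩ := Finset.mem_image.1 hψ
      obtain ⟨x1, x2, x3⟩ := hQ hx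
      refine (h1 _ x1).extend ha haJ hJ x3 (fun y hy => ?_) fun y hy => ?_
      · exact (G.mem_neighborFinset _ _).1 (Finset.mem_sdiff.1 (x2 hy)).1
      · exact (Finset.mem_sdiff.1 (x2 hy)).2
    · intro ψ hψ ψ' hψ' h
      obtain ⟨x, hx, rfl⟩ := Finset.mem_image.1 hψ
      obtain ⟨y, hy, rfl⟩ := Finset.mem_image.1 hψ'
      rw [hinj hx hy h]
    · rw [Finset.card_image_of_injOn fun x hx y hy h => hinj hx hy fun u _ => congrFun h u,
        Finset.card_sigma, Finset.prod_insert ha, mul_comm]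
      calc _ ≤ Ψ.card * (d - K).choose (τ a) := Nat.mul_le_mul_right _ h3
        _ = ∑ _φ ∈ Ψ, (d - K).choose (τ a) := by rw [Finset.sum_const, smul_eq_mul]
        _ ≤ _ := by
          refine Finset.sum_le_sum fun φ _ => ?_
          rw [Finset.card_powersetCard]
          refine Nat.choose_le_choose _ ?_
          have hd : (G.neighborFinset (φ a)).card = d := by
            rw [SimpleGraph.card_neighborFinset_eq_degree, hG]
          have := Finset.le_card_sdiff ((childVerts τ J).image φ) (G.neighborFinset (φ a))
          have := Finset.card_image_le (s := childVerts τ J) (f := φ)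
          change d - K ≤ (G.neighborFinset (φ a) \ (childVerts τ J).image φ).card
          omega

end Counting

/-! ### Lower bound for the probability of a given ball -/

section Probability

variable {V : Type*} [LinearOrder V] {τ : List ℕ → ℕ} {r : ℕ} {v : V} {φ : List ℕ → V}

/-- The sets of edges for which the ball of radius `r` around `v` is the tree `τ`. -/
def chartEvent (τ : List ℕ → ℕ) (r : ℕ) (v : V) : Set (Finset (Sym2 V)) :=
  {S | ∃ φ, IsOrderedChart (SimpleGraph.fromEdgeSet (S : Set (Sym2 V))) τ r v φ}

/-- The edges of the embedded tree. -/
noncomputable def chartEdges (τ : List ℕ → ℕ) (r : ℕ) (φ : List ℕ → V) : Finset (Sym2 V) :=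
  (innerVerts τ r).biUnion fun u => (Finset.range (τ u)).image fun i => s(φ u, φ (i :: u))

theorem mem_chartEdges {e : Sym2 V} :
    e ∈ chartEdges τ r φ ↔ ∃ u ∈ innerVerts τ r, ∃ i < τ u, e = s(φ u, φ (i :: u)) := by
  simp [chartEdges, eq_comm]

theorem card_chartEdges_le : (chartEdges τ r φ).card ≤ ∑ u ∈ innerVerts τ r, τ u :=
  Finset.card_biUnion_le.trans (Finset.sum_le_sum fun u _ => by
    simpa using Finset.card_image_le (s := Finset.range (τ u)) (f := fun i => s(φ u, φ (i :: u))))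

variable [Fintype V] {G : SimpleGraph V} [DecidableRel G.Adj]

variable (G) in
/-- The edges outside of the embedded tree which have to be closed. -/
noncomputable def chartNonEdges (τ : List ℕ → ℕ) (r : ℕ) (φ : List ℕ → V) : Finset (Sym2 V) :=
  (G.edgeFinset.filter fun e => (∃ u ∈ innerVerts τ r, φ u ∈ e) ∨
    ∃ u ∈ treeVerts τ r, ∃ w ∈ treeVerts τ r, e = s(φ u, φ w)) \ chartEdges τ r φ

/-- The first term counts the `d` edges at each inner vertex, the second the pairs of tree vertices;
pairs of vertices at depth `r` are not covered by the first. -/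
theorem card_chartNonEdges_le {d : ℕ} (hG : G.IsRegularOfDegree d) :
    (chartNonEdges G τ r φ).card ≤ d * (innerVerts τ r).card + (treeVerts τ r).card ^ 2 := by
  classical
  have hsub : chartNonEdges G τ r φ ⊆
      ((innerVerts τ r).biUnion fun u => G.incidenceFinset (φ u)) ∪
        ((treeVerts τ r) ×ˢ (treeVerts τ r)).image fun x => s(φ x.1, φ x.2) := by
    intro e he
    rw [chartNonEdges, Finset.mem_sdiff, Finset.mem_filter] at he
    obtain ⟨⟨he, ⟨u, hu, h⟩ | ⟨u, hu, w, hw, rfl⟩⟩, -⟩ := he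
    · refine Finset.mem_union_left _ (Finset.mem_biUnion.2 ⟨u, hu, ?_⟩)
      rw [SimpleGraph.mem_incidenceFinset]
      exact ⟨SimpleGraph.mem_edgeFinset.1 he, h⟩
    · exact Finset.mem_union_right _ (Finset.mem_image.2 ⟨(u, w), by simp_all, rfl⟩)
  refine (Finset.card_le_card hsub).trans ((Finset.card_union_le _ _).trans (add_le_add ?_ ?_))
  · rw [mul_comm]
    refine Finset.card_biUnion_le_card_mul _ _ _ fun u _ => ?_
    rw [SimpleGraph.card_incidenceFinset_eq_degree, hG]
  · refine Finset.card_image_le.trans ?_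
    rw [Finset.card_product, sq]

theorem IsPreChart.chartEdges_subset (h : IsPreChart G τ (innerVerts τ r) v φ) :
    chartEdges τ r φ ⊆ G.edgeFinset := by
  intro e he
  obtain ⟨u, hu, i, hi, rfl⟩ := mem_chartEdges.1 he
  exact SimpleGraph.mem_edgeFinset.2 (h.adj u hu i hi)

/-- An open edge that meets an inner vertex or joins two tree vertices must be a tree edge, since
the others are closed. The first kind gives `closed`, the second `adj_iff`. -/
theorem IsPreChart.isOrderedChart (h : IsPreChart G τ (innerVerts τ r) v φ)
    {S : Finset (Sym2 V)} (hS : S ⊆ G.edgeFinset) (h₁ : chartEdges τ r φ ⊆ S)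
    (h₂ : Disjoint (chartNonEdges G τ r φ) S) :
    IsOrderedChart (SimpleGraph.fromEdgeSet (S : Set (Sym2 V))) τ r v φ := by
  have hinj : Set.InjOn φ (treeVerts τ r) := by
    have := h.injOn
    rwa [childVerts_innerVerts] at this
  have hchild {u : List ℕ} (hu : u ∈ innerVerts τ r) {i : ℕ} (hi : i < τ u) :
      i :: u ∈ treeVerts τ r := by
    rw [← childVerts_innerVerts]
    exact cons_mem_childVerts.2 ⟨hu, hi⟩
  have hparent {u : List ℕ} {i : ℕ} (hi : i :: u ∈ treeVerts τ r) :
      u ∈ innerVerts τ r ∧ i < τ u := by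
    rw [← childVerts_innerVerts] at hi
    exact cons_mem_childVerts.1 hi
  have hclosed {e : Sym2 V} (he : e ∈ S) (hE : (∃ u ∈ innerVerts τ r, φ u ∈ e) ∨
      ∃ u ∈ treeVerts τ r, ∃ w ∈ treeVerts τ r, e = s(φ u, φ w)) : e ∈ chartEdges τ r φ := by
    by_contra hcon
    refine Finset.disjoint_left.1 h₂ ?_ he
    exact Finset.mem_sdiff.2 ⟨Finset.mem_filter.2 ⟨hS he, hE⟩, hcon⟩
  have hopen {u : List ℕ} {i : ℕ} (hi : i :: u ∈ treeVerts τ r) :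
      s(φ u, φ (i :: u)) ∈ S ∧ φ u ≠ φ (i :: u) := by
    obtain ⟨hu, hi'⟩ := hparent hi
    exact ⟨h₁ (mem_chartEdges.2 ⟨u, hu, i, hi', rfl⟩), (h.adj u hu i hi').ne⟩
  refine ⟨⟨h.root, hinj, ?_, ?_⟩, ?_⟩
  · intro u hu w hw
    rw [SimpleGraph.fromEdgeSet_adj, Finset.mem_coe]
    constructor
    · rintro ⟨he, -⟩
      obtain ⟨x, hx, i, hi, heq⟩ := mem_chartEdges.1 (hclosed he (Or.inr ⟨u, hu, w, hw, rfl⟩))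
      have hx' := innerVerts_subset _ _ hx
      have hxi := hchild hx hi
      rcases Sym2.eq_iff.1 heq with ⟨e1, e2⟩ | ⟨e1, e2⟩
      · rw [hinj hu hx' e1, hinj hw hxi e2]
        exact Or.inr ⟨i, rfl⟩
      · rw [hinj hu hxi e1, hinj hw hx' e2]
        exact Or.inl ⟨i, rfl⟩
    · rintro (⟨i, rfl⟩ | ⟨i, rfl⟩)
      · rw [Sym2.eq_swap]
        exact ⟨(hopen hu).1, (hopen hu).2.symm⟩
      · exact hopen hw
  · intro u hu hr y hy
    rw [SimpleGraph.fromEdgeSet_adj, Finset.mem_coe] at hy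
    have hu' : u ∈ innerVerts τ r := Finset.mem_filter.2 ⟨hu, hr⟩
    obtain ⟨x, hx, i, hi, heq⟩ := mem_chartEdges.1
      (hclosed hy.1 (Or.inl ⟨u, hu', Sym2.mem_mk_left _ _⟩))
    rcases Sym2.eq_iff.1 heq with ⟨-, e2⟩ | ⟨-, e2⟩
    · exact ⟨_, hchild hx hi, e2⟩
    · exact ⟨_, innerVerts_subset _ _ hx, e2⟩
  · exact fun u hu hr => h.mono u (Finset.mem_filter.2 ⟨hu, hr⟩)

/-- A lower bound for the probability that the ball of radius `r` around `v` is the tree `τ`. -/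
theorem le_bernExp_chartEvent {d : ℕ} (hG : G.IsRegularOfDegree d) {p : ℝ} (h0 : 0 ≤ p)
    (h1 : p ≤ 1) (τ : List ℕ → ℕ) (r : ℕ) (v : V) :
    (∏ u ∈ innerVerts τ r, ((d - (treeVerts τ r).card).choose (τ u) : ℝ)) *
        (p ^ (∑ u ∈ innerVerts τ r, τ u) *
          (1 - p) ^ (d * (innerVerts τ r).card + (treeVerts τ r).card ^ 2)) ≤
      bernExp p G.edgeFinset ((chartEvent τ r v).indicator 1) := by
  classical
  have hcl (i : ℕ) (w : List ℕ) (h : i :: w ∈ innerVerts τ r) :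
      w ∈ innerVerts τ r ∧ i < τ w := by
    rw [mem_innerVerts] at h ⊢
    exact ⟨⟨h.1.1, (Nat.lt_succ_self _).trans h.2⟩, h.1.2⟩
  obtain ⟨Ψ, hΨ, hsep, hcard⟩ := exists_preCharts G hG τ v (K := (treeVerts τ r).card)
    (innerVerts τ r) hcl (by rw [childVerts_innerVerts])
  let B (φ : List ℕ → V) : Set (Finset (Sym2 V)) :=
    {S | chartEdges τ r φ ⊆ S ∧ Disjoint (chartNonEdges G τ r φ) S}
  have hB (φ : List ℕ → V) (hφ : φ ∈ Ψ) :
      p ^ (∑ u ∈ innerVerts τ r, τ u) *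
          (1 - p) ^ (d * (innerVerts τ r).card + (treeVerts τ r).card ^ 2) ≤
        bernExp p G.edgeFinset ((B φ).indicator 1) := by
    have hsub : chartNonEdges G τ r φ ⊆ G.edgeFinset :=
      Finset.sdiff_subset.trans (Finset.filter_subset _ _)
    have hdis : Disjoint (chartEdges τ r φ) (chartNonEdges G τ r φ) := Finset.disjoint_sdiff
    rw [bernExp_cylinder p (hΨ φ hφ).chartEdges_subset hsub hdis]
    have h1' : 0 ≤ 1 - p := sub_nonneg.2 h1
    exact mul_le_mul (pow_le_pow_of_le_one h0 h1 card_chartEdges_le)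
      (pow_le_pow_of_le_one h1' (by linarith) (card_chartNonEdges_le hG))
      (pow_nonneg h1' _) (pow_nonneg h0 _)
  -- The cylinders `B φ` are disjoint: a common `S` would carry two ordered charts with the same
  -- root, which agree on the tree and hence are equal by `hsep`. So the probabilities of the copies
  -- add up.
  have hsum : ∀ S ⊆ G.edgeFinset,
      ∑ φ ∈ Ψ, (B φ).indicator (1 : Finset (Sym2 V) → ℝ) S ≤ (chartEvent τ r v).indicator 1 S := by
    intro S hS
    by_cases hex : ∃ φ ∈ Ψ, S ∈ B φ
    · obtain ⟨φ, hφ, hφS⟩ := hex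
      have hch := (hΨ φ hφ).isOrderedChart hS hφS.1 hφS.2
      rw [Set.indicator_of_mem (show S ∈ chartEvent τ r v from ⟨φ, hch⟩),
        Finset.sum_eq_single φ]
      · exact Set.indicator_le_self' (fun _ _ => zero_le_one) S
      · intro φ' hφ' hne
        refine Set.indicator_of_notMem (fun hφS' => hne ?_) _
        have hch' := (hΨ φ' hφ').isOrderedChart hS hφS'.1 hφS'.2
        refine hsep _ hφ' _ hφ fun u hu => ?_
        rw [childVerts_innerVerts] at hu
        exact (hch'.agree hch u hu).2.1
      · exact fun h => absurd hφ h
    · rw [Finset.sum_eq_zero]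
      · exact Set.indicator_nonneg (fun _ _ => zero_le_one) S
      · exact fun φ hφ => Set.indicator_of_notMem (fun h => hex ⟨φ, hφ, h⟩) _
  have h1' : 0 ≤ 1 - p := sub_nonneg.2 h1
  calc _ ≤ (Ψ.card : ℝ) * (p ^ (∑ u ∈ innerVerts τ r, τ u) *
          (1 - p) ^ (d * (innerVerts τ r).card + (treeVerts τ r).card ^ 2)) := by
        refine mul_le_mul_of_nonneg_right ?_ (by positivity)
        exact_mod_cast hcard
    _ = ∑ _φ ∈ Ψ, (p ^ (∑ u ∈ innerVerts τ r, τ u) *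
          (1 - p) ^ (d * (innerVerts τ r).card + (treeVerts τ r).card ^ 2)) := by
        rw [Finset.sum_const, nsmul_eq_mul]
    _ ≤ ∑ φ ∈ Ψ, bernExp p G.edgeFinset ((B φ).indicator 1) := Finset.sum_le_sum hB
    _ = bernExp p G.edgeFinset fun S => ∑ φ ∈ Ψ, (B φ).indicator 1 S :=
        (bernExp_sum p _ Ψ fun φ => (B φ).indicator 1).symm
    _ ≤ _ := bernExp_mono h0 h1 hsum

end Probability

/-! ### Concentration of the tree counts -/

section Variance

variable {V : Type*} [LinearOrder V]

/-- The number of elements of `S` that contain the vertex `x`. -/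
def incCount (S : Finset (Sym2 V)) (x : V) : ℕ := (S.filter fun e => x ∈ e).card

theorem incCount_insert_le (S : Finset (Sym2 V)) (e : Sym2 V) (x : V) :
    incCount (insert e S) x ≤ incCount S x + 1 := by
  unfold incCount
  rw [Finset.filter_insert]
  split_ifs
  · exact Finset.card_insert_le _ _
  · omega

theorem incCount_erase_le (S : Finset (Sym2 V)) (e : Sym2 V) (x : V) :
    incCount (S.erase e) x ≤ incCount S x :=
  Finset.card_le_card (Finset.filter_subset_filter _ (Finset.erase_subset _ _))

variable [Fintype V]

/-- The number of vertices whose ball of radius `r` is the tree `τ`. -/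
noncomputable def treeCount (τ : List ℕ → ℕ) (r : ℕ) (S : Finset (Sym2 V)) : ℝ :=
  ∑ v : V, (chartEvent τ r v).indicator 1 S

theorem degree_fromEdgeSet_le (S : Finset (Sym2 V)) (x : V)
    [DecidableRel (SimpleGraph.fromEdgeSet (S : Set (Sym2 V))).Adj] :
    (SimpleGraph.fromEdgeSet (S : Set (Sym2 V))).degree x ≤ incCount S x := by
  rw [← SimpleGraph.card_neighborFinset_eq_degree]
  refine Finset.card_le_card_of_injOn (fun y => s(x, y)) ?_ ?_
  · intro y hy
    rw [Finset.mem_coe, SimpleGraph.mem_neighborFinset, SimpleGraph.fromEdgeSet_adj] at hy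
    exact Finset.mem_coe.2 (Finset.mem_filter.2 ⟨hy.1, Sym2.mem_mk_left _ _⟩)
  · intro y _ z _ h
    exact Sym2.congr_right.1 h

/-- If `e` misses the image of the chart, the chart survives in `S'`. Otherwise `e` contains some `φ
u`, from which the root is within bounded reach. -/
theorem exists_mem_boundedReach {τ : List ℕ → ℕ} {r : ℕ} {Δ : ℕ} (hΔ : ∀ u, τ u ≤ Δ) {v : V}
    {S S' : Finset (Sym2 V)} {e : Sym2 V} (hSS' : ∀ f, f ≠ e → (f ∈ S ↔ f ∈ S'))
    (hS : S ∈ chartEvent τ r v) (hS' : S' ∉ chartEvent τ r v)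
    [DecidableRel (SimpleGraph.fromEdgeSet (S : Set (Sym2 V))).Adj] :
    ∃ x ∈ e, v ∈ boundedReach (SimpleGraph.fromEdgeSet (S : Set (Sym2 V))) (Δ + 1) x r := by
  obtain ⟨φ, hφ⟩ := hS
  by_cases h : ∃ u ∈ treeVerts τ r, φ u ∈ e
  · obtain ⟨u, hu, hue⟩ := h
    exact ⟨_, hue, hφ.toIsBallChart.root_mem_boundedReach hΔ hu⟩
  · push Not at h
    refine absurd ⟨φ, hφ.congr_graph fun u hu y => ?_⟩ hS'
    have hne : s(φ u, y) ≠ e := by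
      rintro rfl
      exact h u hu (Sym2.mem_mk_left _ _)
    simp only [SimpleGraph.fromEdgeSet_adj, Finset.mem_coe, hSS' _ hne]

theorem card_boundedReach_fromEdgeSet_le {S S' : Finset (Sym2 V)} {x : V}
    (h : incCount S' x ≤ incCount S x + 1) (Δ r : ℕ)
    [DecidableRel (SimpleGraph.fromEdgeSet (S' : Set (Sym2 V))).Adj] :
    (boundedReach (SimpleGraph.fromEdgeSet (S' : Set (Sym2 V))) (Δ + 1) x r).card ≤
      (incCount S x + 2) * (Δ + 2) ^ r := by
  refine (card_boundedReach_le _ _ _ _).trans (Nat.mul_le_mul_right _ ?_)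
  have := degree_fromEdgeSet_le S' x
  omega

/-- Opening or closing an edge changes the number of vertices whose ball is `τ` by a bounded
multiple of the degrees of its endpoints. -/
theorem abs_treeCount_sub_le {τ : List ℕ → ℕ} (r : ℕ) {Δ : ℕ} (hΔ : ∀ u, τ u ≤ Δ)
    (S : Finset (Sym2 V)) (e : Sym2 V) :
    |treeCount τ r (insert e S) - treeCount τ r (S.erase e)| ≤
      2 * ((Δ + 2) ^ r : ℝ) * ∑ x with x ∈ e, ((incCount S x : ℝ) + 2) := by
  classical
  set S₁ := insert e S
  set S₀ := S.erase e
  let R (S : Finset (Sym2 V)) (x : V) : Finset V :=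
    boundedReach (SimpleGraph.fromEdgeSet (S : Set (Sym2 V))) (Δ + 1) x r
  -- The vertices whose indicator may change. Both graphs are needed because the tree ball may exist
  -- only with `e` or only without it.
  let B : Finset V := (Finset.univ.filter fun x => x ∈ e).biUnion fun x => R S₁ x ∪ R S₀ x
  have h10 : ∀ f, f ≠ e → (f ∈ S₁ ↔ f ∈ S₀) := fun f hf => by simp [S₁, S₀, hf]
  have hB (v : V) (hv : v ∉ B) : S₁ ∈ chartEvent τ r v ↔ S₀ ∈ chartEvent τ r v := by
    by_contra hne
    refine hv (Finset.mem_biUnion.2 ?_)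
    by_cases h1 : S₁ ∈ chartEvent τ r v
    · have h0 : S₀ ∉ chartEvent τ r v := fun h0 => hne ⟨fun _ => h0, fun _ => h1⟩
      obtain ⟨x, hx, hxv⟩ := exists_mem_boundedReach hΔ h10 h1 h0
      exact ⟨x, by simpa using hx, Finset.mem_union_left _ hxv⟩
    · have h0 : S₀ ∈ chartEvent τ r v := by
        by_contra h0
        exact hne ⟨fun h => absurd h h1, fun h => absurd h h0⟩
      obtain ⟨x, hx, hxv⟩ := exists_mem_boundedReach hΔ (fun f hf => (h10 f hf).symm) h0 h1
      exact ⟨x, by simpa using hx, Finset.mem_union_right _ hxv⟩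
  have hterm (v : V) : |(chartEvent τ r v).indicator (1 : Finset (Sym2 V) → ℝ) S₁ -
      (chartEvent τ r v).indicator 1 S₀| ≤ if v ∈ B then 1 else 0 := by
    by_cases hv : v ∈ B
    · rw [if_pos hv]
      by_cases h1 : S₁ ∈ chartEvent τ r v <;> by_cases h0 : S₀ ∈ chartEvent τ r v <;>
        simp [h1, h0]
    · rw [if_neg hv]
      have := hB v hv
      by_cases h1 : S₁ ∈ chartEvent τ r v
      · simp [h1, this.1 h1]
      · simp [h1, show S₀ ∉ chartEvent τ r v from fun h => h1 (this.2 h)]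
  have hcard : B.card ≤ ∑ x with x ∈ e, 2 * ((incCount S x + 2) * (Δ + 2) ^ r) := by
    refine Finset.card_biUnion_le.trans (Finset.sum_le_sum fun x _ => ?_)
    rw [two_mul]
    refine (Finset.card_union_le _ _).trans (add_le_add ?_ ?_)
    · exact card_boundedReach_fromEdgeSet_le (incCount_insert_le S e x) Δ r
    · exact card_boundedReach_fromEdgeSet_le ((incCount_erase_le S e x).trans (Nat.le_succ _)) Δ r
  rw [treeCount, treeCount, ← Finset.sum_sub_distrib]
  calc _ ≤ ∑ v : V, |(chartEvent τ r v).indicator (1 : Finset (Sym2 V) → ℝ) S₁ -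
      (chartEvent τ r v).indicator 1 S₀| := Finset.abs_sum_le_sum_abs _ _
    _ ≤ ∑ v : V, if v ∈ B then (1 : ℝ) else 0 := Finset.sum_le_sum fun v _ => hterm v
    _ = B.card := by simp
    _ ≤ ((∑ x with x ∈ e, 2 * ((incCount S x + 2) * (Δ + 2) ^ r) : ℕ) : ℝ) := by
        exact_mod_cast hcard
    _ = _ := by
        push_cast
        rw [Finset.mul_sum]
        exact Finset.sum_congr rfl fun x _ => by ring

variable {G : SimpleGraph V} [DecidableRel G.Adj] {d : ℕ} {p : ℝ}

theorem card_edges_at (hG : G.IsRegularOfDegree d) (x : V) :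
    (G.edgeFinset.filter fun e => x ∈ e).card = d := by
  rw [← hG x, ← SimpleGraph.card_incidenceFinset_eq_degree]
  congr 1
  ext e
  rw [Finset.mem_filter, SimpleGraph.mem_incidenceFinset, SimpleGraph.mem_edgeFinset]
  rfl

theorem bernExp_incCount (hG : G.IsRegularOfDegree d) (p : ℝ) (x : V) :
    bernExp p G.edgeFinset (fun S => (incCount S x : ℝ)) = d * p := by
  have h1 : ∀ S ⊆ G.edgeFinset, (incCount S x : ℝ) =
      ∑ e ∈ G.edgeFinset.filter fun e => x ∈ e,
        Set.indicator {S : Finset (Sym2 V) | {e} ⊆ S ∧ Disjoint ∅ S} 1 S := by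
    intro S hS
    have : ∀ e, Set.indicator {S : Finset (Sym2 V) | {e} ⊆ S ∧ Disjoint ∅ S}
        (1 : Finset (Sym2 V) → ℝ) S = if e ∈ S then 1 else 0 := fun e => by simp [Set.indicator]
    simp only [this]
    rw [← Finset.sum_filter, Finset.filter_filter, Finset.sum_const, nsmul_eq_mul, mul_one,
      incCount]
    congr 2
    ext e
    simp only [Finset.mem_filter]
    exact ⟨fun h => ⟨hS h.1, h.2, h.1⟩, fun h => ⟨h.2.2, h.2.1⟩⟩
  rw [bernExp_congr h1, bernExp_sum]
  calc _ = ∑ e ∈ G.edgeFinset.filter fun e => x ∈ e, p := by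
        refine Finset.sum_congr rfl fun e he => ?_
        rw [bernExp_cylinder p (Finset.singleton_subset_iff.2 (Finset.mem_filter.1 he).1)
          (Finset.empty_subset _) (Finset.disjoint_empty_right _)]
        simp
    _ = d * p := by rw [Finset.sum_const, nsmul_eq_mul, card_edges_at hG]

/-- By Efron–Stein the variance of the degree is at most `d p`: an edge changes it by one if it
contains `x` and by zero otherwise. With mean `d p`, the expected square is at most `(d p)² + 5 d p
+ 4`. -/
theorem bernExp_incCount_sq_le (hG : G.IsRegularOfDegree d) (h0 : 0 ≤ p) (h1 : p ≤ 1) {c : ℝ}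
    (hc : d * p ≤ c) (x : V) :
    bernExp p G.edgeFinset (fun S => ((incCount S x : ℝ) + 2) ^ 2) ≤ c ^ 2 + 5 * c + 4 := by
  have hvar := bernExp_variance_le h0 h1 G.edgeFinset fun S => (incCount S x : ℝ)
  have hdiff (e : Sym2 V) (S : Finset (Sym2 V)) :
      ((incCount (insert e S) x : ℝ) - incCount (S.erase e) x) ^ 2 = if x ∈ e then 1 else 0 := by
    unfold incCount
    rw [Finset.filter_insert, Finset.filter_erase]
    split_ifs with he
    · have : insert e (S.filter fun e => x ∈ e) =
          insert e ((S.filter fun e => x ∈ e).erase e) := by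
        ext f
        by_cases hf : f = e <;> simp [hf]
      rw [this, Finset.card_insert_of_notMem (Finset.notMem_erase _ _)]
      push_cast
      ring
    · have : e ∉ S.filter fun e => x ∈ e := fun h => he (Finset.mem_filter.1 h).2
      rw [Finset.erase_eq_of_notMem this]
      ring
  simp only [hdiff, bernExp_const] at hvar
  rw [← Finset.mul_sum, ← Finset.sum_filter, Finset.sum_const, nsmul_eq_mul, mul_one,
    card_edges_at hG, bernExp_incCount hG] at hvar
  have hexp := bernExp_sq_sub p G.edgeFinset (fun S => (incCount S x : ℝ)) (-2)
  simp only [sub_neg_eq_add] at hexp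
  rw [hexp, bernExp_incCount hG]
  have hdp : 0 ≤ d * p := by positivity
  nlinarith [mul_le_mul hc hc hdp (hdp.trans hc)]

/-- The variance of the number of vertices whose ball is `τ`. -/
theorem treeCount_variance_le (hG : G.IsRegularOfDegree d) (h0 : 0 ≤ p) (h1 : p ≤ 1) {c : ℝ}
    (hc : d * p ≤ c) {τ : List ℕ → ℕ} (r : ℕ) {Δ : ℕ} (hΔ : ∀ u, τ u ≤ Δ) :
    bernExp p G.edgeFinset (fun S => treeCount τ r S ^ 2) -
        bernExp p G.edgeFinset (treeCount τ r) ^ 2 ≤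
      8 * c * (c ^ 2 + 5 * c + 4) * (Δ + 2) ^ (2 * r) * Fintype.card V := by
  refine (bernExp_variance_le h0 h1 G.edgeFinset _).trans ?_
  have hcard (e : Sym2 V) : (Finset.univ.filter fun x => x ∈ e).card ≤ 2 := by
    induction e using Sym2.ind with
    | _ a b =>
      refine le_trans (Finset.card_le_card (t := {a, b}) fun x hx => ?_) Finset.card_le_two
      simpa using hx
  -- The constant `8` is `2²` from squaring times `2` from Cauchy–Schwarz over the at most two
  -- endpoints.
  have hdiff (e : Sym2 V) (S : Finset (Sym2 V)) :
      (treeCount τ r (insert e S) - treeCount τ r (S.erase e)) ^ 2 ≤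
        8 * (Δ + 2) ^ (2 * r) * ∑ x with x ∈ e, ((incCount S x : ℝ) + 2) ^ 2 := by
    have k1 := abs_treeCount_sub_le r hΔ S e
    have k2 := sq_sum_le_card_mul_sum_sq (s := Finset.univ.filter fun x => x ∈ e)
      (f := fun x => ((incCount S x : ℝ) + 2))
    have k3 : ((Finset.univ.filter fun x => x ∈ e).card : ℝ) ≤ 2 := by exact_mod_cast hcard e
    have k4 : 0 ≤ ∑ x with x ∈ e, ((incCount S x : ℝ) + 2) ^ 2 :=
      Finset.sum_nonneg fun x _ => by positivity
    calc _ = |treeCount τ r (insert e S) - treeCount τ r (S.erase e)| ^ 2 := (sq_abs _).symm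
      _ ≤ (2 * ((Δ + 2) ^ r : ℝ) * ∑ x with x ∈ e, ((incCount S x : ℝ) + 2)) ^ 2 :=
          pow_le_pow_left₀ (abs_nonneg _) k1 2
      _ = 4 * (Δ + 2) ^ (2 * r) * (∑ x with x ∈ e, ((incCount S x : ℝ) + 2)) ^ 2 := by ring
      _ ≤ 4 * (Δ + 2) ^ (2 * r) * (2 * ∑ x with x ∈ e, ((incCount S x : ℝ) + 2) ^ 2) :=
          mul_le_mul_of_nonneg_left (k2.trans (mul_le_mul_of_nonneg_right k3 k4)) (by positivity)
      _ = _ := by ring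
  have hM : 0 ≤ c ^ 2 + 5 * c + 4 := by
    have : 0 ≤ c := le_trans (by positivity) hc
    positivity
  calc _ ≤ ∑ e ∈ G.edgeFinset, p * (8 * (Δ + 2) ^ (2 * r) *
          ∑ x with x ∈ e, (c ^ 2 + 5 * c + 4)) := by
        refine Finset.sum_le_sum fun e _ => mul_le_mul_of_nonneg_left ?_ h0
        refine (bernExp_mono h0 h1 fun S _ => hdiff e S).trans ?_
        rw [bernExp_const_mul, bernExp_sum]
        exact mul_le_mul_of_nonneg_left
          (Finset.sum_le_sum fun x _ => bernExp_incCount_sq_le hG h0 h1 hc x) (by positivity)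
    _ = p * (8 * (Δ + 2) ^ (2 * r)) *
          ∑ e ∈ G.edgeFinset, ∑ x with x ∈ e, (c ^ 2 + 5 * c + 4) := by
        rw [Finset.mul_sum]
        exact Finset.sum_congr rfl fun e _ => by ring
    -- Double counting of incidences; the resulting `d p ≤ c` makes the bound linear in the number
    -- of vertices.
    _ = p * (8 * (Δ + 2) ^ (2 * r)) * ∑ x : V, d * (c ^ 2 + 5 * c + 4) := by
        congr 1
        simp only [Finset.sum_filter]
        rw [Finset.sum_comm]
        refine Finset.sum_congr rfl fun x _ => ?_
        rw [← Finset.sum_filter, Finset.sum_const, nsmul_eq_mul, card_edges_at hG]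
    _ = (d * p) * ((c ^ 2 + 5 * c + 4) * (8 * (Δ + 2) ^ (2 * r) * Fintype.card V)) := by
        rw [Finset.sum_const, nsmul_eq_mul, Finset.card_univ]
        ring
    _ ≤ c * ((c ^ 2 + 5 * c + 4) * (8 * (Δ + 2) ^ (2 * r) * Fintype.card V)) :=
        mul_le_mul_of_nonneg_right hc (by positivity)
    _ = _ := by ring

end Variance

/-! ### Comparison with Poisson weights -/

section PoissonComparison

/-- The probability that the first generations of the Galton–Watson tree are `τ`. -/
noncomputable def treeWeight (c : ℝ≥0) (τ : List ℕ → ℕ) (r : ℕ) : ℝ :=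
  ∏ u ∈ innerVerts τ r, (poissonMeasure c).real {τ u}

theorem treeWeight_nonneg (c : ℝ≥0) (τ : List ℕ → ℕ) (r : ℕ) : 0 ≤ treeWeight c τ r :=
  Finset.prod_nonneg fun _ _ => measureReal_nonneg

theorem treeWeight_le_one (c : ℝ≥0) (τ : List ℕ → ℕ) (r : ℕ) : treeWeight c τ r ≤ 1 :=
  Finset.prod_le_one (fun _ _ => measureReal_nonneg) fun _ _ => measureReal_le_one

theorem one_sub_mul_le_pow {x : ℝ} (hx : x ≤ 1) (n : ℕ) : 1 - n * x ≤ (1 - x) ^ n := by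
  have := one_add_mul_le_pow (a := -x) (by linarith) n
  rw [← sub_eq_add_neg] at this
  linarith

theorem one_sub_sub_sub_le {x y z : ℝ} (hx : 0 ≤ x) (hy : 0 ≤ y) (hz : 0 ≤ z)
    (hz1 : z ≤ 1) : 1 - (x + y + z) ≤ (1 - x) * (1 - y) * (1 - z) := by
  have h1 : 1 - (x + y) ≤ (1 - x) * (1 - y) := by nlinarith
  have h2 := mul_le_mul_of_nonneg_right h1 (sub_nonneg.2 hz1)
  nlinarith

/-- The binomial offspring probabilities, with a small number of excluded vertices, are at least
the Poisson ones, up to a small error. -/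
theorem treeWeight_sub_le (c : ℝ≥0) (τ : List ℕ → ℕ) (r : ℕ) {d : ℕ} (hd : 1 ≤ d)
    {p : ℝ} (h0 : 0 ≤ p) (h1 : p ≤ 1) (hp : (c : ℝ) ≤ d → p = c / d) {K : ℕ}
    (hK : (treeVerts τ r).card ≤ K) :
    treeWeight c τ r - (2 + c + c ^ 2) * K ^ 2 / d ≤
      (∏ u ∈ innerVerts τ r, ((d - (treeVerts τ r).card).choose (τ u) : ℝ)) *
        (p ^ (∑ u ∈ innerVerts τ r, τ u) *
          (1 - p) ^ (d * (innerVerts τ r).card + (treeVerts τ r).card ^ 2)) := by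
  have h1' : 0 ≤ 1 - p := sub_nonneg.2 h1
  have hd0 : (0 : ℝ) < d := by exact_mod_cast hd
  have hc0 : (0 : ℝ) ≤ c := c.2
  have hT := card_treeVerts_eq τ r
  have hk : (innerVerts τ r).card ≤ (treeVerts τ r).card :=
    Finset.card_le_card (innerVerts_subset τ r)
  set T := (treeVerts τ r).card
  set k := (innerVerts τ r).card
  set m := ∑ u ∈ innerVerts τ r, τ u with hm
  -- If the error term is at least `1`, the left side is nonpositive. Otherwise `d` dominates `2 K`,
  -- `c` and `c²`.
  rcases le_total (d : ℝ) ((2 + c + c ^ 2) * K ^ 2) with hbig | hsmall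
  · have := (one_le_div hd0).2 hbig
    have := treeWeight_le_one c τ r
    exact le_trans (by linarith) (mul_nonneg (Finset.prod_nonneg fun _ _ => Nat.cast_nonneg _)
      (mul_nonneg (pow_nonneg h0 _) (pow_nonneg h1' _)))
  have hK1 : (1 : ℝ) ≤ K := by exact_mod_cast (by omega : 1 ≤ K)
  have hKK : (K : ℝ) ≤ K ^ 2 := by nlinarith
  have hKK1 : (1 : ℝ) ≤ K ^ 2 := hK1.trans hKK
  have h2K : 2 * (K : ℝ) ≤ d := by
    nlinarith [mul_nonneg hc0 (sq_nonneg (K : ℝ)), sq_nonneg (c * K : ℝ)]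
  have hcd : (c : ℝ) ≤ d := by
    nlinarith [mul_le_mul_of_nonneg_left hKK1 hc0, sq_nonneg (c * K : ℝ)]
  have hccd : (c : ℝ) ^ 2 ≤ d := by
    nlinarith [mul_le_mul_of_nonneg_left hKK1 (sq_nonneg (c : ℝ)),
      mul_nonneg hc0 (sq_nonneg (K : ℝ))]
  have hpd := hp hcd
  have hdp : d * p = c := by rw [hpd]; field_simp
  -- `x` is the relative loss per child from excluded vertices and the falling factorial, `y` the
  -- loss per inner vertex in replacing `exp (-c)` by `(1 - p) ^ d`.
  set x : ℝ := 2 * K / d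
  set y : ℝ := c ^ 2 / d
  have hx1 : x ≤ 1 := (div_le_one hd0).2 h2K
  have hy1 : y ≤ 1 := (div_le_one hd0).2 hccd
  have hchoose (u : List ℕ) (hu : u ∈ innerVerts τ r) :
      (1 - x) ^ τ u * ((c : ℝ) ^ τ u / (τ u).factorial) ≤ ((d - T).choose (τ u) : ℝ) * p ^ τ u := by
    have hτ : τ u ≤ m := Finset.single_le_sum (fun _ _ => Nat.zero_le _) hu
    have h3 := Nat.pow_le_choose (α := ℝ) (τ u) (d - T)
    have h4 : (d : ℝ) - 2 * K ≤ ((d - T + 1 - τ u : ℕ) : ℝ) := by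
      have : d ≤ d - T + 1 - τ u + 2 * K := by omega
      have : (d : ℝ) ≤ ((d - T + 1 - τ u : ℕ) : ℝ) + 2 * K := by exact_mod_cast this
      linarith
    have h5 := pow_le_pow_left₀ (by linarith) h4 (τ u)
    have h6 : (1 - x) * c = (d - 2 * K) * p := by
      rw [hpd]
      simp only [x]
      field_simp
    rw [← mul_div_assoc, ← mul_pow, h6, mul_pow, mul_comm, mul_div_assoc, mul_comm]
    refine mul_le_mul_of_nonneg_right ?_ (pow_nonneg h0 _)
    exact (div_le_div_of_nonneg_right h5 (Nat.cast_nonneg _)).trans h3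
  -- From `exp (-p) (1 + p) ≤ 1` one gets `exp (-p) (1 - p²) ≤ 1 - p`; take `d`-th powers and use
  -- Bernoulli, with `d p² = y`.
  have hexp : Real.exp (-c) * (1 - y) ≤ (1 - p) ^ d := by
    have h3 : Real.exp (-c) = Real.exp (-p) ^ d := by
      rw [← Real.exp_nat_mul, ← hdp]
      congr 1
      ring
    have h4 : 1 - y ≤ (1 - p ^ 2) ^ d := by
      refine le_trans (le_of_eq ?_) (one_sub_mul_le_pow (pow_le_one₀ h0 h1) d)
      simp only [y]
      rw [hpd]
      field_simp
    rw [h3]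
    refine (mul_le_mul_of_nonneg_left h4 (by positivity)).trans ?_
    rw [← mul_pow]
    refine pow_le_pow_left₀ (mul_nonneg (Real.exp_nonneg _) ?_) ?_ d
    · exact sub_nonneg.2 (pow_le_one₀ h0 h1)
    · have h5 : Real.exp (-p) * (1 + p) ≤ 1 := by
        have := mul_le_mul_of_nonneg_left (Real.add_one_le_exp p) (Real.exp_nonneg (-p))
        rwa [← Real.exp_add, neg_add_cancel, Real.exp_zero, add_comm] at this
      calc _ = (Real.exp (-p) * (1 + p)) * (1 - p) := by ring
        _ ≤ 1 * (1 - p) := mul_le_mul_of_nonneg_right h5 h1'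
        _ = _ := one_mul _
  have hW : treeWeight c τ r = Real.exp (-c) ^ k *
      ∏ u ∈ innerVerts τ r, ((c : ℝ) ^ τ u / (τ u).factorial) := by
    rw [treeWeight, ← Finset.prod_const, ← Finset.prod_mul_distrib]
    refine Finset.prod_congr rfl fun u _ => ?_
    rw [poissonMeasure_real_singleton, mul_div_assoc]
  have hprod : (1 - x) ^ m * ∏ u ∈ innerVerts τ r, ((c : ℝ) ^ τ u / (τ u).factorial) ≤
      (∏ u ∈ innerVerts τ r, ((d - T).choose (τ u) : ℝ)) * p ^ m := by
    rw [hm, ← Finset.prod_pow_eq_pow_sum, ← Finset.prod_pow_eq_pow_sum,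
      ← Finset.prod_mul_distrib, ← Finset.prod_mul_distrib]
    refine Finset.prod_le_prod (fun u _ => ?_) hchoose
    exact mul_nonneg (pow_nonneg (sub_nonneg.2 hx1) _) (by positivity)
  have hW0 := treeWeight_nonneg c τ r
  have hW1 := treeWeight_le_one c τ r
  have hmain : treeWeight c τ r * ((1 - x) ^ m * (1 - y) ^ k * (1 - p) ^ T ^ 2) ≤
      (∏ u ∈ innerVerts τ r, ((d - T).choose (τ u) : ℝ)) *
        (p ^ m * (1 - p) ^ (d * k + T ^ 2)) := by
    calc _ = ((1 - x) ^ m * ∏ u ∈ innerVerts τ r, ((c : ℝ) ^ τ u / (τ u).factorial)) *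
          ((Real.exp (-c) * (1 - y)) ^ k * (1 - p) ^ T ^ 2) := by
          rw [hW, mul_pow]
          ring
      _ ≤ ((∏ u ∈ innerVerts τ r, ((d - T).choose (τ u) : ℝ)) * p ^ m) *
          (((1 - p) ^ d) ^ k * (1 - p) ^ T ^ 2) := by
          have hy0 : 0 ≤ Real.exp (-c) * (1 - y) :=
            mul_nonneg (Real.exp_nonneg _) (sub_nonneg.2 hy1)
          exact mul_le_mul hprod
            (mul_le_mul_of_nonneg_right (pow_le_pow_left₀ hy0 hexp k) (pow_nonneg h1' _))
            (mul_nonneg (pow_nonneg hy0 _) (pow_nonneg h1' _)) (by positivity)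
      _ = _ := by rw [pow_add, pow_mul]; ring
  refine le_trans ?_ hmain
  have hmK : (m : ℝ) ≤ K := by exact_mod_cast (by omega : m ≤ K)
  have hkK : (k : ℝ) ≤ K := by exact_mod_cast hk.trans hK
  have hTK : ((T ^ 2 : ℕ) : ℝ) ≤ K ^ 2 := by exact_mod_cast Nat.pow_le_pow_left hK 2
  have hx0 : 0 ≤ x := by positivity
  have hy0 : 0 ≤ y := by positivity
  -- `a`, `b`, `g` dominate the total losses `m x`, `k y` and `T² p`; they sum to the stated error.
  set a : ℝ := 2 * K ^ 2 / d
  set b : ℝ := c ^ 2 * K ^ 2 / d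
  set g : ℝ := c * K ^ 2 / d
  have hs : (2 + c + c ^ 2) * K ^ 2 / d = a + b + g := by simp only [a, b, g]; ring
  have ha0 : 0 ≤ a := by positivity
  have hb0 : 0 ≤ b := by positivity
  have hg0 : 0 ≤ g := by positivity
  have hs1 : a + b + g ≤ 1 := by
    rw [← hs]
    exact (div_le_one hd0).2 hsmall
  have hA : 1 - a ≤ (1 - x) ^ m := by
    refine le_trans ?_ (one_sub_mul_le_pow hx1 m)
    have h3 : (K : ℝ) * x = a := by simp only [a, x]; ring
    linarith [mul_le_mul_of_nonneg_right hmK hx0]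
  have hB : 1 - b ≤ (1 - y) ^ k := by
    refine le_trans ?_ (one_sub_mul_le_pow hy1 k)
    have h3 : (K : ℝ) ^ 2 * y = b := by simp only [b, y]; ring
    linarith [mul_le_mul_of_nonneg_right (hkK.trans hKK) hy0]
  have hC : 1 - g ≤ (1 - p) ^ T ^ 2 := by
    refine le_trans ?_ (one_sub_mul_le_pow h1 (T ^ 2))
    have h3 : (K : ℝ) ^ 2 * p = g := by rw [hpd]; simp only [g]; ring
    linarith [mul_le_mul_of_nonneg_right hTK h0]
  have hABC : 1 - (a + b + g) ≤ (1 - x) ^ m * (1 - y) ^ k * (1 - p) ^ T ^ 2 := by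
    refine (one_sub_sub_sub_le ha0 hb0 hg0 (by linarith)).trans ?_
    have ha1 : 0 ≤ 1 - a := by linarith
    have hb1 : 0 ≤ 1 - b := by linarith
    have hg1 : 0 ≤ 1 - g := by linarith
    exact mul_le_mul (mul_le_mul hA hB hb1 (ha1.trans hA)) hC hg1
      (mul_nonneg (ha1.trans hA) (hb1.trans hB))
  rw [hs]
  have h3 := mul_le_mul_of_nonneg_left hABC hW0
  have h4 := mul_le_mul_of_nonneg_right hW1 (by linarith : 0 ≤ a + b + g)
  linarith

end PoissonComparison

/-! ### Plane trees with bounded offspring -/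

section BoundedTrees

theorem IsGWVertex.mono_of_le {N M : List ℕ → ℕ} {u : List ℕ}
    (h : ∀ w, IsGWVertex N w → w.length < u.length → N w ≤ M w) (hu : IsGWVertex N u) :
    IsGWVertex M u := by
  induction u with
  | nil => trivial
  | cons i u ih =>
    refine ⟨ih (fun w hw hl => h w hw (hl.trans (Nat.lt_succ_self _))) hu.1, ?_⟩
    exact hu.2.trans_le (h u hu.1 (Nat.lt_succ_self _))

theorem card_treeVerts_const_le (Δ r : ℕ) :
    (treeVerts (fun _ => Δ) r).card ≤ (Δ + 1) ^ r := by
  induction r with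
  | zero =>
    have : innerVerts (fun _ => Δ) 0 = ∅ := by
      ext u
      simp [mem_innerVerts]
    rw [card_treeVerts_eq, this]
    simp
  | succ r ih =>
    have : innerVerts (fun _ => Δ) (r + 1) = treeVerts (fun _ => Δ) r := by
      ext u
      rw [mem_innerVerts, mem_treeVerts, Nat.lt_succ_iff]
    rw [card_treeVerts_eq, this, Finset.sum_const, smul_eq_mul, pow_succ]
    have : 1 ≤ (Δ + 1) ^ r := Nat.one_le_pow _ _ (Nat.succ_pos _)
    nlinarith

theorem card_treeVerts_le {τ : List ℕ → ℕ} {Δ : ℕ} (h : ∀ u, τ u ≤ Δ) (r : ℕ) :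
    (treeVerts τ r).card ≤ (Δ + 1) ^ r := by
  refine (Finset.card_le_card fun u hu => ?_).trans (card_treeVerts_const_le Δ r)
  rw [mem_treeVerts] at hu ⊢
  exact ⟨hu.1.mono_of_le fun w _ _ => h w, hu.2⟩

/-- The offspring numbers of the first `r` generations of trees with at most `Δ` children at every
vertex. -/
noncomputable def boundedTrees (Δ r : ℕ) : Finset (List ℕ → ℕ) := by
  classical
  exact ((innerVerts (fun _ => Δ) r).pi fun _ => Finset.range (Δ + 1)).image fun g =>
    truncOffspring r fun u => if h : u ∈ innerVerts (fun _ => Δ) r then g u h else 0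

theorem mem_boundedTrees {Δ r : ℕ} {τ : List ℕ → ℕ} :
    τ ∈ boundedTrees Δ r ↔ truncOffspring r τ = τ ∧ ∀ u, τ u ≤ Δ := by
  classical
  rw [boundedTrees, Finset.mem_image]
  constructor
  · rintro ⟨g, hg, rfl⟩
    refine ⟨truncOffspring_truncOffspring _ _, fun u => ?_⟩
    unfold truncOffspring
    split_ifs with h1
    · beta_reduce
      split_ifs with h2
      · exact Nat.lt_succ_iff.1 (Finset.mem_range.1 (Finset.mem_pi.1 hg u h2))
      · exact Nat.zero_le _
    · exact Nat.zero_le _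
  · rintro ⟨h1, h2⟩
    refine ⟨fun u _ => τ u, Finset.mem_pi.2 fun u _ =>
      Finset.mem_range.2 (Nat.lt_succ_of_le (h2 u)), ?_⟩
    have : (fun u => if _h : u ∈ innerVerts (fun _ => Δ) r then τ u else 0) = τ := by
      ext u
      by_cases hu : τ u = 0
      · simp [hu]
      · have hu' := isGWVertex_length_lt h1 hu
        exact dif_pos (mem_innerVerts.2 ⟨hu'.1.mono_of_le fun w _ _ => h2 w, hu'.2⟩)
    rw [this, h1]

theorem card_boundedTrees_le (Δ r : ℕ) :
    (boundedTrees Δ r).card ≤ (Δ + 1) ^ (Δ + 1) ^ r := by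
  classical
  refine Finset.card_image_le.trans ?_
  rw [Finset.card_pi, Finset.prod_const, Finset.card_range]
  exact Nat.pow_le_pow_right (Nat.succ_pos _)
    ((Finset.card_le_card (innerVerts_subset _ r)).trans (card_treeVerts_const_le Δ r))

end BoundedTrees

/-! ### The Galton–Watson law on bounded trees -/

section GaltonWatson

instance (c : ℝ≥0) : IsProbabilityMeasure (gwMeasure c) := by
  unfold gwMeasure
  infer_instance

instance (c : ℝ≥0) (r : ℕ) : IsProbabilityMeasure (gwBallLaw c r) :=
  Measure.isProbabilityMeasure_map (measurable_gwBall r).aemeasurable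

theorem gwMeasure_pi (c : ℝ≥0) (J : Finset (List ℕ)) (t : List ℕ → Set ℕ) :
    (gwMeasure c).real (Set.pi J t) = ∏ u ∈ J, (poissonMeasure c).real (t u) := by
  rw [measureReal_def, gwMeasure, Measure.infinitePi_pi _ fun _ _ => MeasurableSet.of_discrete,
    ENNReal.toReal_prod]
  rfl

/-- The event prescribes the independent offspring numbers at the inner vertices of `τ`. -/
theorem gwMeasure_truncOffspring_le (c : ℝ≥0) (r : ℕ) (τ : List ℕ → ℕ) :
    (gwMeasure c).real {N | truncOffspring r N = τ} ≤ treeWeight c τ r := by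
  rw [treeWeight, ← gwMeasure_pi c (innerVerts τ r) fun u => {τ u}]
  refine measureReal_mono ?_
  rintro N rfl u hu
  rw [Finset.mem_coe, mem_innerVerts] at hu
  exact (truncOffspring_of_mem ((isGWVertex_truncOffspring hu.2.le).1 hu.1) hu.2).symm

/-- The Poisson distribution has exponential tails. -/
theorem exists_poisson_tail (c : ℝ≥0) :
    ∃ C : ℝ, 0 ≤ C ∧ ∀ Δ : ℕ, (poissonMeasure c).real {n | Δ < n} ≤ C * Real.exp (-(2 * Δ)) := by
  -- Markov's inequality for `exp (2 n)`. Of the decay `exp (-2Δ)`, one half will absorb polynomial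
  -- factors, the other half beats `ε`.
  have hint : Integrable (fun n : ℕ => Real.exp (2 * n)) (poissonMeasure c) := by
    rw [integrable_poissonMeasure_iff]
    refine ((Real.summable_pow_div_factorial (c * Real.exp 2)).mul_left (Real.exp (-c))).congr
      fun n => ?_
    rw [Real.norm_of_nonneg (Real.exp_nonneg _), mul_pow, ← Real.exp_nat_mul, mul_comm (n : ℝ) 2]
    ring
  refine ⟨∫ n : ℕ, Real.exp (2 * n) ∂poissonMeasure c,
    integral_nonneg fun n => Real.exp_nonneg _, fun Δ => ?_⟩
  have h := mul_meas_ge_le_integral_of_nonneg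
    (ae_of_all _ fun n : ℕ => Real.exp_nonneg (2 * (n : ℝ)))
    hint (Real.exp (2 * Δ))
  have hsub : (poissonMeasure c).real {n | Δ < n} ≤
      (poissonMeasure c).real {n : ℕ | Real.exp (2 * Δ) ≤ Real.exp (2 * n)} := by
    refine measureReal_mono fun n hn => ?_
    have : (Δ : ℝ) ≤ n := by exact_mod_cast (le_of_lt hn)
    exact Real.exp_le_exp.2 (by linarith)
  rw [Real.exp_neg, ← div_eq_mul_inv, le_div_iff₀ (Real.exp_pos _), mul_comm]
  exact (mul_le_mul_of_nonneg_left hsub (Real.exp_nonneg _)).trans h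

/-- A first violation on any branch occurs inside the deterministic `Δ`-ary tree, so a union bound
over its at most `(Δ + 1) ^ r` inner words suffices. -/
theorem gwMeasure_not_boundedTrees_le {c : ℝ≥0} {Δ : ℕ} {t : ℝ} (ht : 0 ≤ t)
    (h : (poissonMeasure c).real {n | Δ < n} ≤ t) (r : ℕ) :
    (gwMeasure c).real {N | truncOffspring r N ∉ boundedTrees Δ r} ≤ (Δ + 1) ^ r * t := by
  have hsub : {N | truncOffspring r N ∉ boundedTrees Δ r} ⊆
      ⋃ u ∈ innerVerts (fun _ => Δ) r, Set.pi ({u} : Finset (List ℕ)) fun _ => {n | Δ < n} := by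
    intro N hN
    by_contra hcon
    simp only [Finset.coe_singleton, Set.singleton_pi, Set.mem_iUnion, not_exists] at hcon
    have hle (u : List ℕ) (hu : u ∈ innerVerts (fun _ => Δ) r) : N u ≤ Δ := by
      have := hcon u hu
      simpa using this
    have hW (u : List ℕ) : IsGWVertex N u → u.length < r → u ∈ innerVerts (fun _ => Δ) r := by
      induction u with
      | nil => exact fun _ hr => mem_innerVerts.2 ⟨trivial, hr⟩
      | cons i u ih =>
        intro hu hr
        have hu' := ih hu.1 ((Nat.lt_succ_self _).trans hr)
        exact mem_innerVerts.2 ⟨⟨(mem_innerVerts.1 hu').1, hu.2.trans_le (hle u hu')⟩, hr⟩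
    refine hN (mem_boundedTrees.2 ⟨truncOffspring_truncOffspring r N, fun u => ?_⟩)
    unfold truncOffspring
    split_ifs with hu
    · exact hle u (hW u hu.1 hu.2)
    · exact Nat.zero_le _
  calc _ ≤ (gwMeasure c).real (⋃ u ∈ innerVerts (fun _ => Δ) r,
        Set.pi ({u} : Finset (List ℕ)) fun _ => {n | Δ < n}) :=
        measureReal_mono hsub (measure_ne_top _ _)
    _ ≤ ∑ u ∈ innerVerts (fun _ => Δ) r,
        (gwMeasure c).real (Set.pi ({u} : Finset (List ℕ)) fun _ => {n | Δ < n}) :=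
        measureReal_biUnion_finset_le _ _
    _ ≤ ∑ u ∈ innerVerts (fun _ => Δ) r, t := by
        refine Finset.sum_le_sum fun u _ => ?_
        rw [gwMeasure_pi, Finset.prod_singleton]
        exact h
    _ ≤ _ := by
        rw [Finset.sum_const, nsmul_eq_mul]
        refine mul_le_mul_of_nonneg_right ?_ ht
        exact_mod_cast (Finset.card_le_card (innerVerts_subset _ r)).trans
          (card_treeVerts_const_le Δ r)

open Classical in
theorem gwBallLaw_le {c : ℝ≥0} {Δ : ℕ} {t : ℝ} (ht : 0 ≤ t)
    (h : (poissonMeasure c).real {n | Δ < n} ≤ t) (r : ℕ) (A : Set RootedClass) :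
    (gwBallLaw c r).real A ≤ (Δ + 1) ^ r * t +
      ∑ τ ∈ boundedTrees Δ r with ballClass (gwTree τ) (gwRoot τ) r ∈ A, treeWeight c τ r := by
  rw [gwBallLaw, map_measureReal_apply (measurable_gwBall r) MeasurableSet.of_discrete]
  have hsub : (fun N : List ℕ → ℕ => ballClass (gwTree N) (gwRoot N) r) ⁻¹' A ⊆
      {N | truncOffspring r N ∉ boundedTrees Δ r} ∪
        ⋃ τ ∈ (boundedTrees Δ r).filter fun τ => ballClass (gwTree τ) (gwRoot τ) r ∈ A,
          {N | truncOffspring r N = τ} := by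
    intro N hN
    by_cases hN' : truncOffspring r N ∈ boundedTrees Δ r
    · refine Or.inr (Set.mem_biUnion (x := truncOffspring r N) ?_ rfl)
      refine Finset.mem_coe.2 (Finset.mem_filter.2 ⟨hN', ?_⟩)
      rw [← ballClass_gwTree_truncOffspring]
      exact hN
    · exact Or.inl hN'
  refine (measureReal_mono hsub (measure_ne_top _ _)).trans
    ((measureReal_union_le _ _).trans (add_le_add ?_ ?_))
  · exact gwMeasure_not_boundedTrees_le ht h r
  · exact (measureReal_biUnion_finset_le _ _).trans
      (Finset.sum_le_sum fun τ _ => gwMeasure_truncOffspring_le c r τ)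

end GaltonWatson

/-! ### From tree counts to total variation -/

section TotalVariation

/-- The reverse inequality is the hypothesis for the complement. This is why lower bounds on tree
counts suffice. -/
theorem tvDist_le_of_forall {Ω : Type*} [MeasurableSpace Ω] {μ ν : Measure Ω}
    [IsProbabilityMeasure μ] [IsProbabilityMeasure ν] {δ : ℝ}
    (h : ∀ A, MeasurableSet A → ν.real A ≤ μ.real A + δ) : tvDist μ ν ≤ δ := by
  have : Nonempty {A : Set Ω // MeasurableSet A} := ⟨⟨∅, MeasurableSet.empty⟩⟩
  refine ciSup_le fun A => abs_le.2 ⟨?_, ?_⟩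
  · linarith [h A.1 A.2]
  · have h1 := h A.1ᶜ A.2.compl
    rw [probReal_compl_eq_one_sub A.2, probReal_compl_eq_one_sub A.2] at h1
    linarith

theorem abs_sub_le_tvDist {Ω : Type*} [MeasurableSpace Ω] (μ ν : Measure Ω)
    [IsProbabilityMeasure μ] [IsProbabilityMeasure ν] {A : Set Ω} (hA : MeasurableSet A) :
    |μ.real A - ν.real A| ≤ tvDist μ ν := by
  refine le_ciSup (f := fun A : {A : Set Ω // MeasurableSet A} => |μ.real A.1 - ν.real A.1|)
    ⟨1, ?_⟩ ⟨A, hA⟩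
  rintro _ ⟨B, rfl⟩
  have h1 := measureReal_nonneg (μ := μ) (s := B.1)
  have h2 := measureReal_nonneg (μ := ν) (s := B.1)
  have h3 := measureReal_le_one (μ := μ) (s := B.1)
  have h4 := measureReal_le_one (μ := ν) (s := B.1)
  exact abs_le.2 ⟨by linarith, by linarith⟩

variable {V : Type*} [Fintype V]

theorem empiricalBallLaw_real (H : SimpleGraph V) (r : ℕ) (A : Set RootedClass) :
    (empiricalBallLaw H r).real A =
      (∑ v : V, A.indicator 1 (ballClass H v r)) / Fintype.card V := by
  rw [measureReal_def, empiricalBallLaw, Measure.smul_apply, Measure.finsetSum_apply,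
    smul_eq_mul, ENNReal.toReal_mul, ENNReal.toReal_inv, ENNReal.toReal_natCast,
    ENNReal.toReal_sum, inv_mul_eq_div]
  · congr 1
    refine Finset.sum_congr rfl fun v _ => ?_
    rw [Measure.dirac_apply' _ MeasurableSet.of_discrete]
    by_cases h : ballClass H v r ∈ A <;> simp [h]
  · intro v _
    exact measure_ne_top _ _

instance [Nonempty V] (H : SimpleGraph V) (r : ℕ) :
    IsProbabilityMeasure (empiricalBallLaw H r) := by
  refine ⟨?_⟩
  rw [empiricalBallLaw, Measure.smul_apply, Measure.finsetSum_apply]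
  simp only [measure_univ, Finset.sum_const, Finset.card_univ, nsmul_eq_mul, mul_one, smul_eq_mul]
  exact ENNReal.inv_mul_cancel (by simp) (by simp)

variable [LinearOrder V]

-- By `offspring_unique` a vertex is counted for at most one `τ`, and then its ball class lies in
-- `A`. Balls that are not bounded trees are simply discarded.
open Classical in
theorem sum_treeCount_le (r : ℕ) (Δ : ℕ) (S : Finset (Sym2 V)) (A : Set RootedClass) :
    (∑ τ ∈ boundedTrees Δ r with ballClass (gwTree τ) (gwRoot τ) r ∈ A, treeCount τ r S) /
        Fintype.card V ≤
      (empiricalBallLaw (SimpleGraph.fromEdgeSet (S : Set (Sym2 V))) r).real A := by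
  rw [empiricalBallLaw_real]
  refine div_le_div_of_nonneg_right ?_ (Nat.cast_nonneg _)
  simp only [treeCount]
  rw [Finset.sum_comm]
  refine Finset.sum_le_sum fun v _ => ?_
  set B := (boundedTrees Δ r).filter fun τ => ballClass (gwTree τ) (gwRoot τ) r ∈ A
  by_cases hex : ∃ τ ∈ B, S ∈ chartEvent τ r v
  · obtain ⟨τ, hτ, φ, hφ⟩ := hex
    have hτ' := Finset.mem_filter.1 hτ
    rw [Finset.sum_eq_single τ, Set.indicator_of_mem (show S ∈ chartEvent τ r v from ⟨φ, hφ⟩),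
      Set.indicator_of_mem (s := A)]
    · simp
    · rw [hφ.toIsBallChart.ballClass_eq]
      exact hτ'.2
    · rintro τ' hτ'' hne
      refine Set.indicator_of_notMem (fun h => hne ?_) _
      obtain ⟨φ', hφ'⟩ := h
      exact hφ'.offspring_unique hφ
        (mem_boundedTrees.1 (Finset.mem_filter.1 hτ'').1).1 (mem_boundedTrees.1 hτ'.1).1
    · exact fun h => absurd hτ h
  · rw [Finset.sum_eq_zero]
    · exact Set.indicator_nonneg (fun _ _ => zero_le_one) _
    · exact fun τ hτ => Set.indicator_of_notMem (fun h => hex ⟨τ, hτ, h⟩) _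

/-- If every bounded tree is represented sufficiently often, then the total variation distance is
small. -/
theorem tvDist_empirical_le [Nonempty V] {c : ℝ≥0} {Δ : ℕ} {t : ℝ} (ht : 0 ≤ t)
    (h : (poissonMeasure c).real {n | Δ < n} ≤ t) (r : ℕ) (S : Finset (Sym2 V)) {δ : ℝ}
    (hδ : 0 ≤ δ)
    (hcount : ∀ τ ∈ boundedTrees Δ r,
      treeWeight c τ r ≤ treeCount τ r S / Fintype.card V + δ) :
    tvDist (empiricalBallLaw (SimpleGraph.fromEdgeSet (S : Set (Sym2 V))) r) (gwBallLaw c r) ≤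
      (Δ + 1) ^ r * t + (boundedTrees Δ r).card * δ := by
  classical
  refine tvDist_le_of_forall fun A _ => (gwBallLaw_le ht h r A).trans ?_
  set B := (boundedTrees Δ r).filter fun τ => ballClass (gwTree τ) (gwRoot τ) r ∈ A
  have h1 : ∑ τ ∈ B, treeWeight c τ r ≤
      (∑ τ ∈ B, treeCount τ r S) / Fintype.card V + B.card * δ := by
    rw [Finset.sum_div, ← nsmul_eq_mul, ← Finset.sum_const, ← Finset.sum_add_distrib]
    exact Finset.sum_le_sum fun τ hτ => hcount τ (Finset.mem_filter.1 hτ).1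
  have h2 : (B.card : ℝ) * δ ≤ (boundedTrees Δ r).card * δ :=
    mul_le_mul_of_nonneg_right (by exact_mod_cast Finset.card_filter_le _ _) hδ
  have h3 := sum_treeCount_le r Δ S A
  linarith

end TotalVariation

/-! ### The non-asymptotic bound -/

section FiniteEstimate

theorem edgeProb_mul_le (c : ℝ≥0) (d : ℕ) : (d : ℝ) * edgeProb c d ≤ c := by
  have h : (edgeProb c d : ℝ) ≤ c / d := min_le_left _ _
  rcases Nat.eq_zero_or_pos d with rfl | hd
  · simp
  · have hd' : (0 : ℝ) < d := by exact_mod_cast hd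
    rw [mul_comm]
    exact (le_div_iff₀ hd').1 h

theorem edgeProb_eq {c : ℝ≥0} {d : ℕ} (h : (c : ℝ) ≤ d) : (edgeProb c d : ℝ) = c / d :=
  min_eq_left (div_le_one_of_le₀ h (Nat.cast_nonneg _))

theorem treeCount_expectation_ge {V : Type*} [Fintype V] [LinearOrder V] {G : SimpleGraph V}
    [DecidableRel G.Adj] {d : ℕ} (hd : 1 ≤ d) (hG : G.IsRegularOfDegree d) (c : ℝ≥0)
    {τ : List ℕ → ℕ} {Δ : ℕ} (hΔ : ∀ u, τ u ≤ Δ) (r : ℕ) :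
    Fintype.card V * (treeWeight c τ r - (2 + c + c ^ 2) * ((Δ + 1 : ℝ) ^ r) ^ 2 / d) ≤
      bernExp (edgeProb c d) G.edgeFinset (treeCount τ r) := by
  have h0 := (edgeProb c d).2.1
  have h1 := (edgeProb c d).2.2
  have hK := card_treeVerts_le hΔ r
  have key := treeWeight_sub_le c τ r hd h0 h1 edgeProb_eq hK
  push_cast at key
  calc _ = ∑ _v : V, (treeWeight c τ r - (2 + c + c ^ 2) * ((Δ + 1 : ℝ) ^ r) ^ 2 / d) := by
        rw [Finset.sum_const, nsmul_eq_mul, Finset.card_univ]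
    _ ≤ ∑ v : V, bernExp (edgeProb c d) G.edgeFinset ((chartEvent τ r v).indicator 1) :=
        Finset.sum_le_sum fun v _ => key.trans (le_bernExp_chartEvent hG h0 h1 τ r v)
    _ = _ := (bernExp_sum _ _ Finset.univ fun v => (chartEvent τ r v).indicator 1).symm

/-- The non-asymptotic form of the local limit theorem. -/
theorem percolation_tvDist_le {V : Type*} [Fintype V] [Nonempty V] {G : SimpleGraph V}
    [DecidableRel G.Adj] {d : ℕ} (hd : 1 ≤ d) (hG : G.IsRegularOfDegree d) (c : ℝ≥0) {Δ r : ℕ}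
    {t ε Q : ℝ} (ht : 0 ≤ t) (hε : 0 < ε) (hQ : ((boundedTrees Δ r).card : ℝ) ≤ Q) (hQ0 : 0 < Q)
    (htail : (poissonMeasure c).real {n | Δ < n} ≤ t) (ht' : (Δ + 1) ^ r * t ≤ ε / 4)
    (herr : (2 + c + c ^ 2) * ((Δ + 1 : ℝ) ^ r) ^ 2 / d ≤ ε / (4 * Q)) :
    (percolation G (edgeProb c d)).real
        {H | ε ≤ tvDist (empiricalBallLaw H r) (gwBallLaw c r)} ≤
      128 * (c * (c ^ 2 + 5 * c + 4)) * (Q ^ 3 * (Δ + 2) ^ (2 * r) / (d * ε ^ 2)) := by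
  classical
  -- An arbitrary order: it only serves to order siblings, and the conclusion does not involve it.
  let : LinearOrder V := LinearOrder.lift' (Fintype.equivFin V) (Fintype.equivFin V).injective
  have h0 := (edgeProb c d).2.1
  have h1 := (edgeProb c d).2.2
  have hc0 : (0 : ℝ) ≤ c := c.2
  have hd0 : (0 : ℝ) < d := by exact_mod_cast hd
  -- A `d`-regular graph has more than `d` vertices, so Chebyshev's `1 / n` becomes `1 / d`.
  have hdn : (d : ℝ) ≤ Fintype.card V := by
    obtain ⟨v⟩ := ‹Nonempty V›
    rw [← hG v]
    exact_mod_cast (G.degree_lt_card_verts v).le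
  set n : ℝ := (Fintype.card V : ℝ)
  have hn0 : 0 < n := hd0.trans_le hdn
  set p : ℝ := (edgeProb c d : ℝ)
  -- Each tree may lose `ε / (2 Q)`: one half for the bias `herr`, the other for the fluctuation `η
  -- / n`. The total is at most `ε / 2`, plus `ε / 4` for unbounded trees, which is less than `ε`.
  set η : ℝ := n * (ε / (4 * Q))
  have hη : 0 < η := by positivity
  let bad (τ : List ℕ → ℕ) : Set (Finset (Sym2 V)) :=
    {S | treeCount τ r S + η ≤ bernExp p G.edgeFinset (treeCount τ r)}
  have hbad (τ : List ℕ → ℕ) (hτ : τ ∈ boundedTrees Δ r) :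
      bernExp p G.edgeFinset ((bad τ).indicator 1) ≤
        128 * (c * (c ^ 2 + 5 * c + 4)) * (Q ^ 2 * (Δ + 2) ^ (2 * r) / (d * ε ^ 2)) := by
    refine (bernExp_chebyshev h0 h1 _ _ hη).trans ?_
    have hvar := treeCount_variance_le hG h0 h1 (edgeProb_mul_le c d) r (mem_boundedTrees.1 hτ).2
    refine (div_le_div_of_nonneg_right hvar (by positivity)).trans ?_
    calc _ = 128 * (c * (c ^ 2 + 5 * c + 4)) * (Q ^ 2 * (Δ + 2) ^ (2 * r) / (n * ε ^ 2)) := by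
          simp only [η]
          field_simp
          ring
      _ ≤ _ := by gcongr
  rw [percolation_real_eq]
  calc _ ≤ bernExp p G.edgeFinset fun S => ∑ τ ∈ boundedTrees Δ r, (bad τ).indicator 1 S := by
        refine bernExp_mono h0 h1 fun S _ => ?_
        have hnn (τ : List ℕ → ℕ) : 0 ≤ (bad τ).indicator (1 : Finset (Sym2 V) → ℝ) S :=
          Set.indicator_nonneg (fun _ _ => zero_le_one) _
        refine Set.indicator_apply_le' (fun hS => ?_) fun _ => Finset.sum_nonneg fun τ _ => hnn τ
        by_contra hlt
        have hgood (τ : List ℕ → ℕ) (hτ : τ ∈ boundedTrees Δ r) : S ∉ bad τ := by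
          intro hmem
          refine hlt (le_trans ?_ (Finset.single_le_sum (fun τ _ => hnn τ) hτ))
          rw [Set.indicator_of_mem hmem]
        have htv := tvDist_empirical_le ht htail r S (δ := ε / (2 * Q)) (by positivity)
          fun τ hτ => by
            have h2 := hgood τ hτ
            have h3 := treeCount_expectation_ge hd hG c (mem_boundedTrees.1 hτ).2 r
            have h4 : bernExp p G.edgeFinset (treeCount τ r) < treeCount τ r S + η := not_le.1 h2
            have h5 : n * (treeWeight c τ r - ε / (4 * Q)) ≤ treeCount τ r S + η :=
              (mul_le_mul_of_nonneg_left (by linarith) hn0.le).trans (h3.trans h4.le)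
            have h6 : n * (treeWeight c τ r - ε / (2 * Q)) ≤ treeCount τ r S := by
              have : ε / (2 * Q) = ε / (4 * Q) + ε / (4 * Q) := by
                field_simp
                ring
              rw [this]
              simp only [η] at h5
              linarith
            have h7 := (le_div_iff₀' hn0).2 h6
            linarith
        have h8 : ((boundedTrees Δ r).card : ℝ) * (ε / (2 * Q)) ≤ ε / 2 := by
          calc _ ≤ Q * (ε / (2 * Q)) := mul_le_mul_of_nonneg_right hQ (by positivity)
            _ = ε / 2 := by field_simp
        have h9 : ε ≤ tvDist (empiricalBallLaw (SimpleGraph.fromEdgeSet (S : Set (Sym2 V))) r)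
          (gwBallLaw c r) := hS
        linarith
    _ = ∑ τ ∈ boundedTrees Δ r, bernExp p G.edgeFinset ((bad τ).indicator 1) :=
        bernExp_sum _ _ _ fun τ => (bad τ).indicator 1
    _ ≤ ∑ τ ∈ boundedTrees Δ r,
        128 * (c * (c ^ 2 + 5 * c + 4)) * (Q ^ 2 * (Δ + 2) ^ (2 * r) / (d * ε ^ 2)) :=
        Finset.sum_le_sum hbad
    _ = (boundedTrees Δ r).card *
        (128 * (c * (c ^ 2 + 5 * c + 4)) * (Q ^ 2 * (Δ + 2) ^ (2 * r) / (d * ε ^ 2))) := by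
        rw [Finset.sum_const, nsmul_eq_mul]
    _ ≤ Q * (128 * (c * (c ^ 2 + 5 * c + 4)) * (Q ^ 2 * (Δ + 2) ^ (2 * r) / (d * ε ^ 2))) :=
        mul_le_mul_of_nonneg_right hQ (by positivity)
    _ = _ := by ring

end FiniteEstimate

/-! ### Growth estimates for the choice of parameters -/

section Asymptotics

theorem eventually_log_bound {r : ℕ} (hr : 1 ≤ r) :
    ∀ᶠ x : ℝ in atTop, 3 * ((x + 3) ^ r * Real.log (x + 3)) + 2 * r * Real.log (x + 3) + (x + 3) ≤
      x ^ (2 * r) / 3 := by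
  -- The three terms have coefficients `3`, `2 r`, `1`, and `(x + 3) ^ (2 * r)` costs `4 ^ r`
  -- through `x + 3 ≤ 2 x`; this `η` leaves exactly `1 / 3`.
  set η : ℝ := 1 / (3 * (4 + 2 * r) * 4 ^ r) with hη
  have hη0 : 0 < η := by positivity
  have hlog : ∀ᶠ y : ℝ in atTop, ‖Real.log y‖ ≤ η * ‖y‖ :=
    (Real.isLittleO_log_id_atTop.def hη0)
  have htend : Tendsto (fun x : ℝ => x + 3) atTop atTop :=
    tendsto_atTop_add_const_right _ _ tendsto_id
  filter_upwards [htend.eventually hlog, eventually_ge_atTop 3, eventually_ge_atTop (1 / η)]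
    with x h1 h2 h3
  set y := x + 3 with hy
  have hy1 : 1 ≤ y := by linarith
  have hy0 : 0 ≤ y := by linarith
  have hl : Real.log y ≤ η * y := by
    rw [Real.norm_of_nonneg (Real.log_nonneg hy1), Real.norm_of_nonneg hy0] at h1
    exact h1
  have hpow {k : ℕ} (hk : k ≤ 2 * r) : y ^ k ≤ y ^ (2 * r) := pow_le_pow_right₀ hy1 hk
  have e1 : y ^ r * Real.log y ≤ η * y ^ (2 * r) := by
    calc y ^ r * Real.log y ≤ y ^ r * (η * y) := mul_le_mul_of_nonneg_left hl (by positivity)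
      _ = η * y ^ (r + 1) := by ring
      _ ≤ _ := mul_le_mul_of_nonneg_left (hpow (by omega)) hη0.le
  have e2 : Real.log y ≤ η * y ^ (2 * r) := by
    refine hl.trans (mul_le_mul_of_nonneg_left ?_ hη0.le)
    simpa using hpow (k := 1) (by omega)
  have e3 : y ≤ η * y ^ (2 * r) := by
    have h4 : 1 ≤ η * y := by
      have := (div_le_iff₀' hη0).1 (h3.trans (by linarith : x ≤ y))
      linarith
    calc y ≤ (η * y) * y := le_mul_of_one_le_left hy0 h4
      _ = η * y ^ 2 := by ring
      _ ≤ _ := mul_le_mul_of_nonneg_left (hpow (by omega)) hη0.le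
  have e4 : y ^ (2 * r) ≤ 4 ^ r * x ^ (2 * r) := by
    calc y ^ (2 * r) ≤ (2 * x) ^ (2 * r) := pow_le_pow_left₀ hy0 (by linarith) _
      _ = _ := by rw [mul_pow, pow_mul 2]; norm_num
  calc _ ≤ (4 + 2 * r) * (η * y ^ (2 * r)) := by
        have := mul_le_mul_of_nonneg_left e2 (by positivity : (0 : ℝ) ≤ 2 * r)
        linarith
    _ ≤ (4 + 2 * r) * (η * (4 ^ r * x ^ (2 * r))) := by gcongr
    _ = _ := by
        rw [hη]
        field_simp

/-- With `exp (x ^ (2 * r)) = d` and `exp (x / 2) = ε⁻²`, this bounds the cost of the union bound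
and of Chebyshev by `d ^ (1 / 3)`. The exponent `2 r` is what makes the logarithm of the number of
trees, of order `x ^ r * log x`, negligible. -/
theorem eventually_exp_bound {r : ℕ} (hr : 1 ≤ r) :
    ∀ᶠ x : ℝ in atTop, (((⌈x⌉₊ + 1 : ℕ) : ℝ) ^ (⌈x⌉₊ + 1) ^ r) ^ 3 * ((⌈x⌉₊ : ℝ) + 2) ^ (2 * r) *
      Real.exp (x / 2) ≤ Real.exp (x ^ (2 * r)) ^ (1 / 3 : ℝ) := by
  filter_upwards [eventually_log_bound hr, eventually_ge_atTop 0] with x hx hx0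
  have hceil : (⌈x⌉₊ : ℝ) < x + 1 := Nat.ceil_lt_add_one hx0
  set y := x + 3 with hy
  have hy1 : 1 ≤ y := by linarith
  have hy0 : 0 < y := by linarith
  have hl : 0 ≤ Real.log y := Real.log_nonneg hy1
  have hexp : Real.exp (Real.log y) = y := Real.exp_log hy0
  have b1 : ((⌈x⌉₊ + 1 : ℕ) : ℝ) ≤ y := by push_cast; linarith
  have b2 : ((⌈x⌉₊ : ℝ) + 2) ≤ y := by linarith
  have c1 : ((⌈x⌉₊ + 1 : ℕ) : ℝ) ^ (⌈x⌉₊ + 1) ^ r ≤ Real.exp (y ^ r * Real.log y) := by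
    calc _ ≤ Real.exp (Real.log y) ^ (⌈x⌉₊ + 1) ^ r := by
          rw [hexp]
          exact pow_le_pow_left₀ (Nat.cast_nonneg _) b1 _
      _ = Real.exp ((((⌈x⌉₊ + 1) ^ r : ℕ) : ℝ) * Real.log y) := (Real.exp_nat_mul _ _).symm
      _ ≤ _ := by
          refine Real.exp_le_exp.2 (mul_le_mul_of_nonneg_right ?_ hl)
          rw [Nat.cast_pow]
          exact pow_le_pow_left₀ (Nat.cast_nonneg _) b1 _
  have c2 : ((⌈x⌉₊ : ℝ) + 2) ^ (2 * r) ≤ Real.exp (2 * r * Real.log y) := by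
    have : Real.exp (2 * r * Real.log y) = y ^ (2 * r) := by
      rw [← hexp, ← Real.exp_nat_mul, hexp]
      push_cast
      rfl
    rw [this]
    exact pow_le_pow_left₀ (by positivity) b2 _
  calc _ ≤ Real.exp (y ^ r * Real.log y) ^ 3 * Real.exp (2 * r * Real.log y) *
        Real.exp (x / 2) := by gcongr
    _ = Real.exp (3 * (y ^ r * Real.log y) + 2 * r * Real.log y + x / 2) := by
        rw [Real.exp_add, Real.exp_add, ← Real.exp_nat_mul]
        norm_num
    _ ≤ Real.exp (x ^ (2 * r) / 3) := Real.exp_le_exp.2 (by linarith)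
    _ = _ := by
        rw [← Real.exp_mul]
        congr 1
        ring

theorem eventually_tail_bound (C : ℝ) (r : ℕ) :
    ∀ᶠ x : ℝ in atTop, ((⌈x⌉₊ : ℝ) + 1) ^ r * (C * Real.exp (-(2 * ⌈x⌉₊))) ≤
      Real.exp (-(1 / 4) * x) / 4 := by
  have h1 : Tendsto (fun y : ℝ => 4 * |C| * Real.exp 1 * (y ^ r * Real.exp (-y))) atTop (𝓝 0) := by
    simpa using (Real.tendsto_pow_mul_exp_neg_atTop_nhds_zero r).const_mul (4 * |C| * Real.exp 1)
  have h2 : Tendsto (fun x : ℝ => (⌈x⌉₊ : ℝ) + 1) atTop atTop :=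
    tendsto_atTop_add_const_right _ _ (tendsto_natCast_atTop_atTop.comp tendsto_nat_ceil_atTop)
  filter_upwards [(h1.comp h2).eventually (gt_mem_nhds zero_lt_one), eventually_ge_atTop 0]
    with x hx hx0
  have hle : x ≤ ⌈x⌉₊ := Nat.le_ceil x
  set D : ℝ := (⌈x⌉₊ : ℝ)
  simp only [Function.comp] at hx
  have e1 : Real.exp (-(2 * D)) = Real.exp 1 * Real.exp (-(D + 1)) * Real.exp (-D) := by
    rw [← Real.exp_add, ← Real.exp_add]
    congr 1
    ring
  have e2 : Real.exp (-D) ≤ Real.exp (-(1 / 4) * x) := Real.exp_le_exp.2 (by linarith)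
  have hD : 0 ≤ D := Nat.cast_nonneg _
  calc _ ≤ (D + 1) ^ r * (|C| * Real.exp (-(2 * D))) := by
        gcongr
        exact le_abs_self C
    _ = (4 * |C| * Real.exp 1 * ((D + 1) ^ r * Real.exp (-(D + 1)))) * (Real.exp (-D) / 4) := by
        rw [e1]
        ring
    _ ≤ 1 * (Real.exp (-D) / 4) := mul_le_mul_of_nonneg_right hx.le (by positivity)
    _ ≤ _ := by linarith

end Asymptotics

/-! ### The limit theorem -/

section Main

variable (c : ℝ≥0) (V : ℕ → Type*) [∀ d, Fintype (V d)] [∀ d, Nonempty (V d)]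
  (G : ∀ d, SimpleGraph (V d)) [∀ d, DecidableRel (G d).Adj]

theorem isLittleO_percolation_tvDist (hG : ∀ d, 1 ≤ d → (G d).IsRegularOfDegree d) {r : ℕ}
    (hr : 1 ≤ r) :
    (fun d : ℕ => (percolation (G d) (edgeProb c d)).real
      {H : SimpleGraph (V d) | Real.exp (-(1 / 4) * Real.log d ^ (1 / (2 * r) : ℝ)) ≤
        tvDist (empiricalBallLaw H r) (gwBallLaw c r)})
      =o[atTop] fun d : ℕ => (d : ℝ) ^ (-(1 / 3) : ℝ) := by
  obtain ⟨C, hC, htail⟩ := exists_poisson_tail c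
  have hc0 : (0 : ℝ) ≤ c := c.2
  have hr0 : (0 : ℝ) < 2 * r := by positivity
  set M : ℝ := 128 * (c * (c ^ 2 + 5 * c + 4)) with hM
  have hM0 : 0 ≤ M := by positivity
  have hlog : Tendsto (fun d : ℕ => Real.log d) atTop atTop :=
    Real.tendsto_log_atTop.comp tendsto_natCast_atTop_atTop
  have hx : Tendsto (fun d : ℕ => Real.log d ^ (1 / (2 * r) : ℝ)) atTop atTop :=
    (tendsto_rpow_atTop (by positivity)).comp hlog
  have hpow : Tendsto (fun d : ℕ => (d : ℝ) ^ (-(2 / 3) : ℝ)) atTop (𝓝 0) :=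
    (tendsto_rpow_neg_atTop (by norm_num)).comp tendsto_natCast_atTop_atTop
  have herr : ∀ᶠ d : ℕ in atTop, 4 * (2 + c + c ^ 2) * (d : ℝ) ^ (-(2 / 3) : ℝ) < 1 := by
    have := hpow.const_mul (4 * (2 + c + c ^ 2) : ℝ)
    rw [mul_zero] at this
    exact this.eventually (gt_mem_nhds zero_lt_one)
  have hbound : ∀ᶠ d : ℕ in atTop, (percolation (G d) (edgeProb c d)).real
      {H : SimpleGraph (V d) | Real.exp (-(1 / 4) * Real.log d ^ (1 / (2 * r) : ℝ)) ≤
        tvDist (empiricalBallLaw H r) (gwBallLaw c r)} ≤ M * (d : ℝ) ^ (-(2 / 3) : ℝ) := by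
    filter_upwards [eventually_ge_atTop 1, hx.eventually (eventually_exp_bound hr),
      hx.eventually (eventually_tail_bound C r), hlog.eventually_ge_atTop 0, herr]
      with d hd1 hexp htl hlog0 herr
    have hd0 : (0 : ℝ) < d := by exact_mod_cast hd1
    set x : ℝ := Real.log d ^ (1 / (2 * r) : ℝ) with hxdef
    have hx0 : 0 ≤ x := Real.rpow_nonneg hlog0 _
    have hxd : Real.exp (x ^ (2 * r)) = d := by
      rw [hxdef, ← Real.rpow_natCast, ← Real.rpow_mul hlog0]
      push_cast
      rw [one_div_mul_cancel hr0.ne', Real.rpow_one, Real.exp_log hd0]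
    rw [hxd] at hexp
    set Δ := ⌈x⌉₊
    set Q : ℝ := ((Δ + 1 : ℕ) : ℝ) ^ (Δ + 1) ^ r
    have hQ1 : 1 ≤ Q := one_le_pow₀ (by push_cast; linarith [Nat.cast_nonneg (α := ℝ) Δ])
    have hQ : ((boundedTrees Δ r).card : ℝ) ≤ Q := by
      simp only [Q]
      exact_mod_cast card_boundedTrees_le Δ r
    set ε : ℝ := Real.exp (-(1 / 4) * x)
    have hε0 : 0 < ε := Real.exp_pos _
    have hε2 : Real.exp (x / 2) * ε ^ 2 = 1 := by
      rw [← Real.exp_nat_mul, ← Real.exp_add]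
      push_cast
      ring_nf
      exact Real.exp_zero
    have hε1 : ε ≤ 1 := Real.exp_le_one_iff.2 (by linarith)
    have hd3 : (d : ℝ) ^ (1 / 3 : ℝ) = d * (d : ℝ) ^ (-(2 / 3) : ℝ) := by
      rw [← Real.rpow_one_add' hd0.le (by norm_num)]
      norm_num
    have hΔ0 : (0 : ℝ) ≤ Δ := Nat.cast_nonneg _
    -- The numerator with `ε⁻²` is at most `d ^ (1 / 3)`; dividing by `d` leaves `d ^ (-2 / 3)`,
    -- better than required.
    have hmain : Q ^ 3 * ((Δ : ℝ) + 2) ^ (2 * r) / (d * ε ^ 2) ≤ (d : ℝ) ^ (-(2 / 3) : ℝ) := by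
      rw [div_le_iff₀ (by positivity)]
      calc _ = (Q ^ 3 * ((Δ : ℝ) + 2) ^ (2 * r) * Real.exp (x / 2)) * ε ^ 2 := by
            rw [mul_assoc _ (Real.exp _), hε2, mul_one]
        _ ≤ (d : ℝ) ^ (1 / 3 : ℝ) * ε ^ 2 := mul_le_mul_of_nonneg_right hexp (by positivity)
        _ = _ := by rw [hd3]; ring
    have hsmall : Q * (((Δ : ℝ) + 1) ^ r) ^ 2 ≤ (d : ℝ) ^ (1 / 3 : ℝ) * ε := by
      calc Q * (((Δ : ℝ) + 1) ^ r) ^ 2 ≤ Q ^ 3 * ((Δ : ℝ) + 2) ^ (2 * r) := by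
            rw [← pow_mul, mul_comm r 2]
            have : Q ≤ Q ^ 3 := le_self_pow₀ hQ1 (by norm_num)
            gcongr
            norm_num
        _ = (Q ^ 3 * ((Δ : ℝ) + 2) ^ (2 * r) * Real.exp (x / 2)) * ε ^ 2 := by
            rw [mul_assoc _ (Real.exp _), hε2, mul_one]
        _ ≤ (d : ℝ) ^ (1 / 3 : ℝ) * ε ^ 2 := mul_le_mul_of_nonneg_right hexp (by positivity)
        _ ≤ (d : ℝ) ^ (1 / 3 : ℝ) * ε := by
            refine mul_le_mul_of_nonneg_left ?_ (by positivity)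
            nlinarith
    have herr' : (2 + c + c ^ 2) * (((Δ : ℝ) + 1) ^ r) ^ 2 / d ≤ ε / (4 * Q) := by
      have hQ0 : 0 < Q := by linarith
      rw [div_le_div_iff₀ hd0 (by positivity)]
      calc _ = 4 * (2 + c + c ^ 2) * (Q * (((Δ : ℝ) + 1) ^ r) ^ 2) := by ring
        _ ≤ 4 * (2 + c + c ^ 2) * ((d : ℝ) ^ (1 / 3 : ℝ) * ε) := by gcongr
        _ = (4 * (2 + c + c ^ 2) * (d : ℝ) ^ (-(2 / 3) : ℝ)) * (ε * d) := by rw [hd3]; ring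
        _ ≤ 1 * (ε * d) := mul_le_mul_of_nonneg_right herr.le (by positivity)
        _ = _ := one_mul _
    refine (percolation_tvDist_le hd1 (hG d hd1) c (by positivity) hε0 hQ (by linarith)
      (htail Δ) htl herr').trans ?_
    exact mul_le_mul_of_nonneg_left hmain hM0
  refine IsBigO.trans_isLittleO (g := fun d : ℕ => (d : ℝ) ^ (-(2 / 3) : ℝ)) ?_ ?_
  · refine IsBigO.of_bound M ?_
    filter_upwards [hbound] with d hd
    rw [Real.norm_of_nonneg measureReal_nonneg, Real.norm_of_nonneg (by positivity)]
    exact hd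
  · have hthird : Tendsto (fun d : ℕ => (d : ℝ) ^ (-(1 / 3) : ℝ)) atTop (𝓝 0) :=
      (tendsto_rpow_neg_atTop (by norm_num)).comp tendsto_natCast_atTop_atTop
    have hmul := ((isLittleO_one_iff ℝ).2 hthird).mul_isBigO
      (isBigO_refl (fun d : ℕ => (d : ℝ) ^ (-(1 / 3) : ℝ)) atTop)
    simp only [one_mul] at hmul
    refine hmul.congr_left fun d => ?_
    rw [← Real.rpow_add' (Nat.cast_nonneg d) (by norm_num)]
    norm_num

/-- The total variation distance tested on the singleton class of `K`. -/
theorem abs_card_ball_sub_le {W : Type*} [Fintype W] [Nonempty W] (H : SimpleGraph W) (r : ℕ)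
    (K : FinRooted) :
    |(Nat.card {v : W // RootedIso (ballGraph H v r) (ballRoot H v r) K.graph K.root} : ℝ) /
        Nat.card W - (gwMeasure c).real {N | RootedIso (ballGraph (gwTree N) (gwRoot N) r)
          (ballRoot (gwTree N) (gwRoot N) r) K.graph K.root}| ≤
      tvDist (empiricalBallLaw H r) (gwBallLaw c r) := by
  classical
  have h := abs_sub_le_tvDist (empiricalBallLaw H r) (gwBallLaw c r)
    (A := {Quotient.mk FinRooted.setoid K}) MeasurableSet.of_discrete
  have h1 : (empiricalBallLaw H r).real {Quotient.mk FinRooted.setoid K} =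
      (Nat.card {v : W // RootedIso (ballGraph H v r) (ballRoot H v r) K.graph K.root} : ℝ) /
        Nat.card W := by
    rw [empiricalBallLaw_real, Nat.card_eq_fintype_card, Nat.card_eq_fintype_card,
      Fintype.card_subtype, Finset.card_filter, Nat.cast_sum]
    congr 1
    refine Finset.sum_congr rfl fun v _ => ?_
    have hiff := rootedClass_eq_mk_iff (ballGraph H v r) (ballRoot H v r) K
    by_cases hv : RootedIso (ballGraph H v r) (ballRoot H v r) K.graph K.root
    · rw [if_pos hv, Set.indicator_of_mem (by exact hiff.2 hv)]
      simp
    · rw [if_neg hv, Set.indicator_of_notMem (by exact fun h => hv (hiff.1 h))]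
      simp
  have h2 : (gwBallLaw c r).real {Quotient.mk FinRooted.setoid K} =
      (gwMeasure c).real {N | RootedIso (ballGraph (gwTree N) (gwRoot N) r)
          (ballRoot (gwTree N) (gwRoot N) r) K.graph K.root} := by
    rw [gwBallLaw, map_measureReal_apply (measurable_gwBall r) MeasurableSet.of_discrete]
    congr 1
    ext N
    exact rootedClass_eq_mk_iff _ _ K
  rwa [h1, h2] at h

theorem percolation_convergesLocally (hG : ∀ d, 1 ≤ d → (G d).IsRegularOfDegree d) :
    ConvergesLocallyInProbability (fun d => percolation (G d) (edgeProb c d))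
      (gwMeasure c) gwTree gwRoot := by
  intro r hr K ε hε
  have hlog : Tendsto (fun d : ℕ => Real.log d) atTop atTop :=
    Real.tendsto_log_atTop.comp tendsto_natCast_atTop_atTop
  have hr0 : (0 : ℝ) < 2 * r := by positivity
  have hx : Tendsto (fun d : ℕ => Real.log d ^ (1 / (2 * r) : ℝ)) atTop atTop :=
    (tendsto_rpow_atTop (by positivity)).comp hlog
  have hthr : Tendsto (fun d : ℕ => Real.exp (-(1 / 4) * Real.log d ^ (1 / (2 * r) : ℝ))) atTop
      (𝓝 0) :=
    Real.tendsto_exp_atBot.comp (hx.const_mul_atTop_of_neg (by norm_num))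
  have h0 : Tendsto (fun d : ℕ => (d : ℝ) ^ (-(1 / 3) : ℝ)) atTop (𝓝 0) :=
    (tendsto_rpow_neg_atTop (by norm_num)).comp tendsto_natCast_atTop_atTop
  have hlim := (isLittleO_percolation_tvDist c V G hG hr).trans_tendsto h0
  refine tendsto_of_tendsto_of_tendsto_of_le_of_le' tendsto_const_nhds hlim
    (Eventually.of_forall fun d => measureReal_nonneg) ?_
  -- Once the threshold drops below the fixed `ε`, a deviation of `ε` forces the rare event above.
  filter_upwards [hthr.eventually (gt_mem_nhds hε)] with d hd
  have : IsFiniteMeasure (percolation (G d) (edgeProb c d)) := by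
    unfold percolation
    infer_instance
  exact measureReal_mono fun H hH =>
    hd.le.trans ((show ε ≤ _ from hH).trans (abs_card_ball_sub_le c H r K))

end Main

end LocalLimit

theorem theorem2 (c : ℝ≥0) (hc : 0 < c)
    (V : ℕ → Type*) [∀ d, Fintype (V d)] [∀ d, Nonempty (V d)]
    (G : ∀ d, SimpleGraph (V d)) [∀ d, DecidableRel (G d).Adj]
    (hG : ∀ d, 1 ≤ d → (G d).IsRegularOfDegree d) :
    (∀ r : ℕ, 1 ≤ r →
      (fun d : ℕ => (LocalLimit.percolation (G d) (LocalLimit.edgeProb c d)).real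
          {H : SimpleGraph (V d) |
            Real.exp (-(1 / 4) * Real.log d ^ (1 / (2 * r) : ℝ)) ≤
              LocalLimit.tvDist (LocalLimit.empiricalBallLaw H r) (LocalLimit.gwBallLaw c r)})
        =o[atTop] fun d : ℕ => (d : ℝ) ^ (-(1 / 3) : ℝ)) ∧
    LocalLimit.ConvergesLocallyInProbability
      (fun d => LocalLimit.percolation (G d) (LocalLimit.edgeProb c d))
      (LocalLimit.gwMeasure c) LocalLimit.gwTree LocalLimit.gwRoot := by
  exact ⟨fun _ hr => LocalLimit.isLittleO_percolation_tvDist c V G hG hr,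
    LocalLimit.percolation_convergesLocally c V G hG⟩
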